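/- **Theorem 5.1.** Let $N,p\ge 1$ be integers and let $0<\overline H_1\le \overline H_2\le\cdots\le\overline H_N\le 1$. Let $X=\{X(t),\,t\in\mathbb R^N\}$ be a real-valued, centered Gaussian random field satisfying (D1) there exist constants $\delta_0>0$ and $c\ge 1$ such that for all $s,t\in[0,1]^N$ with $|s-t|\le\delta_0$, $$c^{-1}\sum_{j=1}^N|s_j-t_j|^{2\overline H_j}\;\le\;\mathbb E\big[(X(t)-X(s))^2\big]\;\le\; c\sum_{j=1}^N|s_j-t_j|^{2\overline H_j},$$ where $|\cdot|$ is the Euclidean norm. Let $\mathbf X(t)=(X_1(t),\dots,X_p(t))$, $t\in\mathbb R^N$, where $X_1,\dots,X_p$ are independent copies of $X$ (independent random fields, each with the same finite-dimensional distributions as $X$), and assume that the sample function $t\mapsto\mathbf X(t)$ is almost surely continuous on $[0,1]^N$. Let $\dim$ denote Hausdorff dimension. Then, with probability 1, $$\dim \mathbf X([0,1]^N)=\min\Big\{p,\ \sum_{j=1}^N\frac1{\overline H_j}\Big\},$$ and, with probability 1, the graph $\mathrm{Gr}\,\mathbf X([0,1]^N)=\{(t,\mathbf X(t)):t\in[0,1]^N\}\subset\mathbb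 R^{N+p}$ satisfies $$\dim \mathrm{Gr}\,\mathbf X([0,1]^N)=\min\Big\{\min_{1\le k\le N}\Big(\sum_{j=1}^k\frac{\overline H_k}{\overline H_j}+N-k+(1-\overline H_k)p\Big),\ \sum_{j=1}^N\frac1{\overline H_j}\Big\}.$$ -/

import Mathlib

open MeasureTheory ProbabilityTheory

namespace AnisotropicGaussian

/-- The closed unit cube `[0,1]^N` in Euclidean space `ℝ^N`. -/
def unitCube (N : ℕ) : Set (EuclideanSpace ℝ (Fin N)) :=
  {t | ∀ j, t j ∈ Set.Icc (0 : ℝ) 1}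

/-- `X = {X(t), t ∈ ℝ^N}` is a real-valued centered Gaussian random field: all its
finite-dimensional distributions are Gaussian and every `X(t)` has mean zero. -/
structure IsCenteredGaussianField {N : ℕ} {Ω : Type*} [MeasurableSpace Ω]
    (X : EuclideanSpace ℝ (Fin N) → Ω → ℝ) (P : Measure Ω) : Prop where
  isGaussian : IsGaussianProcess X P
  centered : ∀ t, ∫ ω, X t ω ∂P = 0

/-- Condition (D1): the variogram `E[(X(t) - X(s))²]` is two-sidedly comparable with
`∑ⱼ |sⱼ - tⱼ|^{2Hⱼ}` for all nearby points `s`, `t` of the unit cube. -/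
def ConditionD1 {N : ℕ} {Ω : Type*} [MeasurableSpace Ω]
    (X : EuclideanSpace ℝ (Fin N) → Ω → ℝ) (P : Measure Ω) (H : Fin N → ℝ) : Prop :=
  ∃ δ₀ : ℝ, 0 < δ₀ ∧ ∃ c : ℝ, 1 ≤ c ∧
    ∀ s ∈ unitCube N, ∀ t ∈ unitCube N, ‖s - t‖ ≤ δ₀ →
      c⁻¹ * ∑ j, |s j - t j| ^ (2 * H j) ≤ ∫ ω, (X t ω - X s ω) ^ 2 ∂P ∧
      ∫ ω, (X t ω - X s ω) ^ 2 ∂P ≤ c * ∑ j, |s j - t j| ^ (2 * H j)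

/-- `Xs 0, …, Xs (p-1)` are independent copies of the random field `X`: each of them has the
finite-dimensional distributions of `X`, and they are independent as random fields, that is,
as random elements of `ℝ^N → ℝ` with the product σ-algebra. -/
structure AreIndependentCopies {N p : ℕ} {Ω Ω₀ : Type*} [MeasurableSpace Ω] [MeasurableSpace Ω₀]
    (Xs : Fin p → EuclideanSpace ℝ (Fin N) → Ω → ℝ) (P : Measure Ω)
    (X : EuclideanSpace ℝ (Fin N) → Ω₀ → ℝ) (P₀ : Measure Ω₀) : Prop where
  identDistrib : ∀ (i : Fin p) (I : Finset (EuclideanSpace ℝ (Fin N))),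
    IdentDistrib (fun (ω : Ω) (t : I) => Xs i t ω) (fun (ω : Ω₀) (t : I) => X t ω) P P₀
  indep : iIndepFun (fun (i : Fin p) (ω : Ω) (t : EuclideanSpace ℝ (Fin N)) => Xs i t ω) P

/-- The sample function `t ↦ 𝐗(t) = (X₁(t), …, X_p(t)) ∈ ℝ^p` at `ω`. -/
def sampleFunction {N p : ℕ} {Ω : Type*} (Xs : Fin p → EuclideanSpace ℝ (Fin N) → Ω → ℝ)
    (ω : Ω) (t : EuclideanSpace ℝ (Fin N)) : EuclideanSpace ℝ (Fin p) :=
  WithLp.toLp 2 (fun i => Xs i t ω)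

/-- The graph `{(t, g(t)) : t ∈ S}` of `g` over `S`, in `ℝ^N × ℝ^p` with the Euclidean
distance of `ℝ^{N+p}`. -/
def graphOver {N p : ℕ} (g : EuclideanSpace ℝ (Fin N) → EuclideanSpace ℝ (Fin p))
    (S : Set (EuclideanSpace ℝ (Fin N))) :
    Set (WithLp 2 (EuclideanSpace ℝ (Fin N) × EuclideanSpace ℝ (Fin p))) :=
  (fun t => WithLp.toLp 2 (t, g t)) '' S

end AnisotropicGaussian

/-! Both dimensions come from matching covering and energy bounds, proved for a continuous
measurable version of the field in sup-norm coordinates (`IsRegularGaussianField`); continuous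
linear equivalences carry them back to the Euclidean spaces.

Upper bounds. By chaining over anisotropic grids and Borel–Cantelli, for every `h < 1` almost surely
`|s j - t j| ≤ r ^ (1 / H j)` for all `j` forces an increment of order `r ^ h`, for small dyadic `r`
(`ae_modulus`). For `θ ≥ h`, cut the cube into boxes of sides `r ^ max (1 / H j) θ` and the range
above each box into cubes of side `r ^ θ`. Counting gives `dimH ≤ (∑ max (1 / H j) θ + p (θ - h)) /
θ` for the graph (`dimH_graph_le_of_modulus`). As `h → 1`, `θ = 1 / H k` produces the `k`-th term of
the formula and `θ = h` produces `∑ 1 / H j`. The image is a projection of the graph and lies in a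
`p`-dimensional space.

Lower bounds. Push the uniform measure on a small cube to the image or the graph and show that its
expected `γ`-energy is finite (`ae_le_dimH_image_of_kernel_le`). Let `σ` be the standard deviation
of an increment. For the image and `γ < p` the expected kernel is at most of order `σ ^ (-γ)`; for
the graph and `γ > p` it is at most of order `σ ^ (-p) * |s - t| ^ (p - γ)`. Since `σ` dominates a
multiple of every `|s j - t j| ^ H j`, these powers can be distributed over the coordinates, and the
product is integrable once every coordinate exponent is below 1. For the graph, a greedy allocation
makes this possible below the critical value (`exists_split_exponents`). Exponents below `p` for the
graph are covered by the image. -/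

namespace AnisotropicGaussian

open Set Filter Topology
open scoped ENNReal NNReal

/-! ### Energy and covering criteria for Hausdorff dimension. -/

/-- **Energy method**: a set charged by a measure of finite `γ`-energy has Hausdorff dimension at
least `γ`. -/
theorem le_dimH_of_energy_ne_top {X : Type*} [EMetricSpace X] [MeasurableSpace X] [BorelSpace X]
    [SecondCountableTopology X] (ν : Measure X) [SFinite ν] {γ : ℝ≥0} {A : Set X} (hA : ν A ≠ 0)
    (h : ∫⁻ x, ∫⁻ y, (edist x y)⁻¹ ^ (γ : ℝ) ∂ν ∂ν ≠ ∞) : (γ : ℝ≥0∞) ≤ dimH A := by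
  have hK : Measurable fun z : X × X => (edist z.1 z.2)⁻¹ ^ (γ : ℝ) := by fun_prop
  set φ : X → ℝ≥0∞ := fun x => ∫⁻ y, (edist x y)⁻¹ ^ (γ : ℝ) ∂ν with hφ
  have hφm : Measurable φ := hK.lintegral_prod_right'
  have hfin : ∀ᵐ x ∂ν, φ x < ∞ := ae_lt_top hφm h
  obtain ⟨M, hM⟩ : ∃ M : ℕ, ν (A ∩ {x | φ x ≤ M}) ≠ 0 := by
    by_contra! hcon
    refine hA (measure_mono_null (t := (⋃ M : ℕ, A ∩ {x | φ x ≤ M}) ∪ {x | ¬ φ x < ∞}) ?_ ?_)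
    · intro x hx
      by_cases hx' : φ x < ∞
      · obtain ⟨M, hM⟩ := ENNReal.exists_nat_gt hx'.ne
        exact Or.inl (mem_iUnion.2 ⟨M, hx, hM.le⟩)
      · exact Or.inr hx'
    · exact measure_union_null (measure_iUnion_null hcon) hfin
  set B : Set X := {x | φ x ≤ M}
  have hB : MeasurableSet B := measurableSet_le hφm measurable_const
  -- `M + 1` rather than `M`, so that `c` can be inverted.
  set c : ℝ≥0∞ := ((M + 1 : ℕ) : ℝ≥0∞)
  have hc0 : c ≠ 0 := by simp [c]
  have hct : c ≠ ∞ := ENNReal.natCast_ne_top _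
  -- Mass distribution: a set `s` meeting `B` at `x` has `ν (s ∩ B) * (diam s) ^ (-γ) ≤ φ x ≤ c`, by
  -- Markov's inequality for the kernel based at `x`.
  have key : c⁻¹ • ν.restrict B ≤ μH[(γ : ℝ)] := by
    refine Measure.le_hausdorffMeasure _ _ 1 one_pos fun s hs => ?_
    have hst : Metric.ediam s ≠ ∞ := ne_top_of_le_ne_top ENNReal.one_ne_top hs
    rw [Measure.smul_apply, smul_eq_mul, Measure.restrict_apply' hB,
      ENNReal.inv_mul_le_iff hc0 hct]
    rcases (s ∩ B).eq_empty_or_nonempty with he | ⟨x, hxs, hxB⟩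
    · simp [he]
    have h1 : ν (s ∩ B) * (Metric.ediam s)⁻¹ ^ (γ : ℝ) ≤ c := by
      calc ν (s ∩ B) * (Metric.ediam s)⁻¹ ^ (γ : ℝ)
          ≤ ν {y | (Metric.ediam s)⁻¹ ^ (γ : ℝ) ≤ (edist x y)⁻¹ ^ (γ : ℝ)}
            * (Metric.ediam s)⁻¹ ^ (γ : ℝ) := by
            gcongr
            intro y hy
            exact ENNReal.rpow_le_rpow
              (ENNReal.inv_le_inv.2 (Metric.edist_le_ediam_of_mem hxs hy.1)) γ.2
        _ ≤ φ x := by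
            rw [mul_comm]
            exact mul_meas_ge_le_lintegral (by fun_prop) _
        _ ≤ M := hxB
        _ ≤ c := by simp [c]
    rw [ENNReal.inv_rpow] at h1
    -- If the power of the diameter vanishes, its inverse is `∞`, and finiteness of `c` forces `ν (s
    -- ∩ B) = 0`.
    rcases eq_or_ne (Metric.ediam s ^ (γ : ℝ)) 0 with h0 | h0
    · rw [h0] at h1 ⊢
      by_contra hne
      simp only [mul_zero, nonpos_iff_eq_zero] at hne
      rw [ENNReal.inv_zero, ENNReal.mul_top hne] at h1
      exact hct (top_le_iff.1 h1)
    · have ht : Metric.ediam s ^ (γ : ℝ) ≠ ∞ := ENNReal.rpow_ne_top_of_nonneg γ.2 hst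
      rwa [← div_eq_mul_inv, ENNReal.div_le_iff h0 ht] at h1
  borelize X
  refine le_dimH_of_hausdorffMeasure_ne_zero fun h0 => hM ?_
  have h2 := le_trans (key A) h0.le
  simp only [Measure.smul_apply, smul_eq_mul, Measure.restrict_apply' hB, nonpos_iff_eq_zero,
    mul_eq_zero, ENNReal.inv_eq_zero, hct, false_or] at h2
  exact h2

/-- If `s` has, at scales `ρ n → 0`, covers by at most `C / ρ n ^ d` sets of diameter at most
`ρ n`, then `dimH s ≤ d`. -/
theorem dimH_le_of_finite_covers {X : Type*} [EMetricSpace X] {s : Set X} {d : ℝ≥0} {C : ℝ≥0∞}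
    (hC : C ≠ ∞) {ι : ℕ → Type*} [∀ n, Fintype (ι n)] {ρ : ℕ → ℝ≥0∞}
    (hρ : Tendsto ρ atTop (𝓝 0)) (T : ∀ n, ι n → Set X)
    (hdiam : ∀ᶠ n in atTop, ∀ i, Metric.ediam (T n i) ≤ ρ n)
    (hcover : ∀ᶠ n in atTop, s ⊆ ⋃ i, T n i)
    (hcard : ∀ᶠ n in atTop, (Fintype.card (ι n) : ℝ≥0∞) * ρ n ^ (d : ℝ) ≤ C) :
    dimH s ≤ d := by
  borelize X
  refine dimH_le_of_hausdorffMeasure_ne_top (ne_top_of_le_ne_top hC ?_)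
  refine (Measure.hausdorffMeasure_le_liminf_sum (d : ℝ) s ρ hρ T hdiam hcover).trans ?_
  refine liminf_le_of_frequently_le' (Eventually.frequently ?_)
  filter_upwards [hdiam, hcard] with n h1 h2
  refine le_trans (Finset.sum_le_card_nsmul _ _ (ρ n ^ (d : ℝ)) fun i _ => ?_) ?_
  · exact ENNReal.rpow_le_rpow (h1 i) d.2
  · simpa using h2

theorem abs_sub_le_of_floor_div_eq {a b δ : ℝ} (hδ : 0 < δ)
    (h : ⌊a / δ⌋ = ⌊b / δ⌋) : |a - b| ≤ δ := by
  have h1 := Int.abs_sub_lt_one_of_floor_eq_floor h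
  rw [← sub_div, abs_div, abs_of_pos hδ, div_lt_one hδ] at h1
  exact h1.le

/-- Covering bound for the graph of a function with an anisotropic modulus of continuity. -/
theorem dimH_graph_le_of_modulus {N p : ℕ} {g : (Fin N → ℝ) → (Fin p → ℝ)} {H : Fin N → ℝ}
    {h θ C : ℝ} (hh : 0 < h) (hθ : h ≤ θ) (n₀ : ℕ)
    (hg : ∀ n ≥ n₀, ∀ s ∈ Icc (0 : Fin N → ℝ) 1, ∀ t ∈ Icc (0 : Fin N → ℝ) 1,
      (∀ j, |s j - t j| ≤ ((1 / 2 : ℝ) ^ n) ^ (1 / H j)) →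
        dist (g s) (g t) ≤ C * ((1 / 2 : ℝ) ^ n) ^ h) :
    dimH ((fun t => (t, g t)) '' Icc (0 : Fin N → ℝ) 1) ≤
      ENNReal.ofReal ((∑ j, max (1 / H j) θ + p * (θ - h)) / θ) := by
  have hθ0 : 0 < θ := hh.trans_le hθ
  set r : ℕ → ℝ := fun n => (1 / 2 : ℝ) ^ n with hr
  have hr0 : ∀ n, 0 < r n := fun n => by positivity
  have hr1 : ∀ n, r n ≤ 1 := fun n => pow_le_one₀ (by norm_num) (by norm_num)
  -- The maximum makes the boxes fine enough both for the modulus (`1 / H j`) and for the target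
  -- diameter `r ^ θ`.
  set m : Fin N → ℝ := fun j => max (1 / H j) θ with hm
  have hm0 : ∀ j, 0 < m j := fun j => hθ0.trans_le (le_max_right _ _)
  set δ : ℕ → Fin N → ℝ := fun n j => r n ^ m j with hδ
  have hδ0 : ∀ n j, 0 < δ n j := fun n j => Real.rpow_pos_of_pos (hr0 n) _
  set ρ : ℕ → ℝ := fun n => r n ^ θ with hρ
  have hρ0 : ∀ n, 0 < ρ n := fun n => Real.rpow_pos_of_pos (hr0 n) _
  have hδρ : ∀ n j, δ n j ≤ ρ n := fun n j =>
    Real.rpow_le_rpow_of_exponent_ge (hr0 n) (hr1 n) (le_max_right _ _)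
  have hδH : ∀ n j, δ n j ≤ r n ^ (1 / H j) := fun n j =>
    Real.rpow_le_rpow_of_exponent_ge (hr0 n) (hr1 n) (le_max_left _ _)
  set D : ℝ := |C| with hD
  have hDC : C ≤ D := le_abs_self C
  have hD0 : 0 ≤ D := abs_nonneg C
  -- Oscillation `D * r ^ h` over a box, measured in range cells of side `r ^ θ`.
  set M : ℕ → ℕ := fun n => ⌈D * r n ^ (h - θ)⌉₊ with hM
  set d : ℝ := (∑ j, m j + p * (θ - h)) / θ with hd
  have hd0 : 0 ≤ d := div_nonneg (add_nonneg (Finset.sum_nonneg fun j _ => (hm0 j).le)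
    (mul_nonneg (Nat.cast_nonneg _) (sub_nonneg.2 hθ))) hθ0.le
  let ι : ℕ → Type := fun n => (∀ j : Fin N, Finset.Icc (0 : ℤ) (⌊1 / δ n j⌋₊ : ℤ)) ×
    (Fin p → Finset.Icc (-(M n : ℤ)) (M n : ℤ))
  let base : ∀ n, ι n → Fin N → ℝ := fun n i j => ((i.1 j : ℤ) : ℝ) * δ n j
  -- Range cells are counted from the value of `g` at the lower corner of the box, so their number
  -- depends only on the oscillation.
  let T : ∀ n, ι n → Set ((Fin N → ℝ) × (Fin p → ℝ)) := fun n i =>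
    (fun t => (t, g t)) '' {t | (∀ j, ⌊t j / δ n j⌋ = i.1 j) ∧
      ∀ k, ⌊(g t k - g (base n i) k) / ρ n⌋ = i.2 k}
  have hdN : ENNReal.ofReal d = ((Real.toNNReal d : ℝ≥0) : ℝ≥0∞) := rfl
  rw [hdN]
  refine dimH_le_of_finite_covers (C := ENNReal.ofReal (2 ^ N * (2 * D + 3) ^ p))
    ENNReal.ofReal_ne_top (ι := ι) (ρ := fun n => ENNReal.ofReal (ρ n)) ?_ T ?_ ?_ ?_
  · have h1 : Tendsto ρ atTop (𝓝 0) := by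
      have h2 : Tendsto r atTop (𝓝 0) :=
        tendsto_pow_atTop_nhds_zero_of_lt_one (by norm_num) (by norm_num)
      have := h2.rpow_const (p := θ) (Or.inr hθ0.le)
      rwa [Real.zero_rpow hθ0.ne'] at this
    have := ENNReal.tendsto_ofReal h1
    rwa [ENNReal.ofReal_zero] at this
  · refine Eventually.of_forall fun n i => Metric.ediam_le ?_
    rintro _ ⟨s, ⟨hs1, hs2⟩, rfl⟩ _ ⟨t, ⟨ht1, ht2⟩, rfl⟩
    rw [edist_dist]
    refine ENNReal.ofReal_le_ofReal ?_
    rw [Prod.dist_eq]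
    refine max_le ((dist_pi_le_iff (hρ0 n).le).2 fun j => ?_)
      ((dist_pi_le_iff (hρ0 n).le).2 fun k => ?_)
    · exact (abs_sub_le_of_floor_div_eq (hδ0 n j) ((hs1 j).trans (ht1 j).symm)).trans (hδρ n j)
    · have := abs_sub_le_of_floor_div_eq (hρ0 n) ((hs2 k).trans (ht2 k).symm)
      rwa [sub_sub_sub_cancel_right] at this
  · filter_upwards [eventually_ge_atTop n₀] with n hn
    rintro _ ⟨t, ht, rfl⟩
    have hz : ∀ j, ⌊t j / δ n j⌋ ∈ Finset.Icc (0 : ℤ) (⌊1 / δ n j⌋₊ : ℤ) := fun j => by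
      rw [Finset.mem_Icc]
      refine ⟨Int.floor_nonneg.2 (div_nonneg (ht.1 j) (hδ0 n j).le), ?_⟩
      rw [Int.natCast_floor_eq_floor (by have := hδ0 n j; positivity)]
      exact Int.floor_le_floor (div_le_div_of_nonneg_right (ht.2 j) (hδ0 n j).le)
    set b : Fin N → ℝ := fun j => (⌊t j / δ n j⌋ : ℝ) * δ n j with hb
    have hbt : ∀ j, b j ≤ t j := fun j => by
      have := Int.floor_le (t j / δ n j)
      rwa [le_div_iff₀ (hδ0 n j)] at this
    have htb : ∀ j, t j - b j ≤ δ n j := fun j => by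
      have := (Int.lt_floor_add_one (t j / δ n j)).le
      rw [div_le_iff₀ (hδ0 n j)] at this
      simp only [hb]; linarith
    have hb01 : b ∈ Icc (0 : Fin N → ℝ) 1 := by
      refine ⟨fun j => ?_, fun j => (hbt j).trans (ht.2 j)⟩
      have : (0 : ℝ) ≤ (⌊t j / δ n j⌋ : ℝ) := by
        exact_mod_cast (Finset.mem_Icc.1 (hz j)).1
      exact mul_nonneg this (hδ0 n j).le
    have hgb : dist (g t) (g b) ≤ D * r n ^ h := by
      refine (hg n hn t ht b hb01 fun j => ?_).trans (by gcongr)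
      rw [abs_of_nonneg (sub_nonneg.2 (hbt j))]
      exact (htb j).trans (hδH n j)
    have hw : ∀ k, ⌊(g t k - g b k) / ρ n⌋ ∈ Finset.Icc (-(M n : ℤ)) (M n : ℤ) := fun k => by
      have h1 : |g t k - g b k| ≤ D * r n ^ h := (dist_le_pi_dist (g t) (g b) k).trans hgb
      have h2 : |(g t k - g b k) / ρ n| ≤ M n := by
        rw [abs_div, abs_of_pos (hρ0 n), div_le_iff₀ (hρ0 n)]
        refine h1.trans ?_
        calc D * r n ^ h = D * r n ^ (h - θ) * ρ n := by
              rw [mul_assoc, hρ]; simp only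
              rw [← Real.rpow_add (hr0 n), sub_add_cancel]
          _ ≤ M n * ρ n := mul_le_mul_of_nonneg_right (Nat.le_ceil _) (hρ0 n).le
      rw [abs_le] at h2
      rw [Finset.mem_Icc]
      refine ⟨Int.le_floor.2 (by push_cast; exact h2.1), ?_⟩
      have := Int.floor_le_floor h2.2
      rwa [Int.floor_natCast] at this
    exact mem_iUnion.2 ⟨(fun j => ⟨_, hz j⟩, fun k => ⟨_, hw k⟩), t, ⟨fun j => rfl, fun k => rfl⟩,
      rfl⟩
  · refine Eventually.of_forall fun n => ?_
    have hcard : (Fintype.card (ι n) : ℝ) =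
        (∏ j, ((⌊1 / δ n j⌋₊ : ℝ) + 1)) * (2 * M n + 1) ^ p := by
      simp only [ι, Fintype.card_prod, Fintype.card_pi, Fintype.card_coe, Int.card_Icc,
        Finset.prod_const, Finset.card_univ, Fintype.card_fin]
      push_cast
      congr 1
      · refine Finset.prod_congr rfl fun j _ => ?_
        rw [show ((⌊1 / δ n j⌋₊ : ℤ) + 1 - 0).toNat = ⌊1 / δ n j⌋₊ + 1 by omega]
        push_cast; ring
      · rw [show ((M n : ℤ) + 1 - -(M n : ℤ)).toNat = 2 * M n + 1 by omega]
        push_cast; ring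
    have hρd : ENNReal.ofReal (ρ n) ^ ((Real.toNNReal d : ℝ≥0) : ℝ) =
        ENNReal.ofReal (ρ n ^ d) := by
      rw [Real.coe_toNNReal _ hd0, ENNReal.ofReal_rpow_of_pos (hρ0 n)]
    rw [hρd, ← ENNReal.ofReal_natCast, ← ENNReal.ofReal_mul (Nat.cast_nonneg _), hcard]
    refine ENNReal.ofReal_le_ofReal ?_
    have h1 : ∏ j, ((⌊1 / δ n j⌋₊ : ℝ) + 1) ≤ ∏ j, 2 * r n ^ (-(m j)) := by
      refine Finset.prod_le_prod (fun j _ => by positivity) fun j _ => ?_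
      have e : 1 / δ n j = r n ^ (-(m j)) := by
        rw [Real.rpow_neg (hr0 n).le, one_div]
      have : 1 ≤ r n ^ (-(m j)) :=
        Real.one_le_rpow_of_pos_of_le_one_of_nonpos (hr0 n) (hr1 n) (by linarith [hm0 j])
      have h3 := Nat.floor_le (show 0 ≤ 1 / δ n j by have := hδ0 n j; positivity)
      rw [e] at h3 ⊢; linarith
    have h2 : (2 * (M n : ℝ) + 1) ≤ (2 * D + 3) * r n ^ (h - θ) := by
      have h3 := (Nat.ceil_lt_add_one (show 0 ≤ D * r n ^ (h - θ) from
        mul_nonneg hD0 (Real.rpow_nonneg (hr0 n).le _))).le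
      have : 1 ≤ r n ^ (h - θ) :=
        Real.one_le_rpow_of_pos_of_le_one_of_nonpos (hr0 n) (hr1 n) (by linarith)
      nlinarith
    have h3 : ∏ j, 2 * r n ^ (-(m j)) = 2 ^ N * r n ^ (-∑ j, m j) := by
      rw [Finset.prod_mul_distrib, ← Finset.sum_neg_distrib, Real.rpow_sum_of_pos (hr0 n)]
      simp
    calc (∏ j, ((⌊1 / δ n j⌋₊ : ℝ) + 1)) * (2 * M n + 1) ^ p * ρ n ^ d
        ≤ (2 ^ N * r n ^ (-∑ j, m j)) * ((2 * D + 3) * r n ^ (h - θ)) ^ p * ρ n ^ d := by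
          rw [← h3]
          have := hρ0 n
          gcongr
      _ = 2 ^ N * (2 * D + 3) ^ p * (r n ^ (-∑ j, m j) * r n ^ ((h - θ) * p) * r n ^ (θ * d)) := by
          rw [mul_pow, hρ]; simp only
          rw [← Real.rpow_mul (hr0 n).le, Real.rpow_mul (hr0 n).le (h - θ), Real.rpow_natCast]
          ring
      _ = 2 ^ N * (2 * D + 3) ^ p := by
          rw [← Real.rpow_add (hr0 n), ← Real.rpow_add (hr0 n), hd, mul_div_cancel₀ _ hθ0.ne']
          rw [show -∑ j, m j + (h - θ) * p + (∑ j, m j + p * (θ - h)) = 0 by ring,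
            Real.rpow_zero, mul_one]

/-! ### Integrals of negative powers and Gaussian moments. -/

theorem enorm_inv_rpow_eq_ofReal {x : ℝ} (hx : x ≠ 0) (α : ℝ) :
    ‖x‖ₑ⁻¹ ^ α = ENNReal.ofReal (|x| ^ (-α)) := by
  have h : 0 < |x| := abs_pos.2 hx
  rw [Real.enorm_eq_ofReal_abs, ENNReal.inv_rpow, ← ENNReal.rpow_neg,
    ENNReal.ofReal_rpow_of_pos h]

theorem setLIntegral_enorm_inv_rpow_lt_top {α : ℝ} (hα : α < 1) :
    ∫⁻ x in Icc (-1 : ℝ) 1, ‖x‖ₑ⁻¹ ^ α < ∞ := by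
  have h1 : ∀ᵐ x : ℝ ∂(volume.restrict (Icc (-1 : ℝ) 1)),
      ‖x‖ₑ⁻¹ ^ α = ENNReal.ofReal (|x| ^ (-α)) := by
    refine ae_restrict_of_ae ?_
    have : ∀ᵐ x : ℝ, x ∈ ({0} : Set ℝ)ᶜ := compl_mem_ae_iff.2 (by simp)
    filter_upwards [this] with x hx using enorm_inv_rpow_eq_ofReal hx α
  rw [lintegral_congr_ae h1]
  have h2 : IntervalIntegrable (fun x : ℝ => |x| ^ (-α)) volume 0 1 := by
    refine (intervalIntegral.intervalIntegrable_rpow' (r := -α) (by linarith)).congr ?_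
    intro x hx
    rw [uIoc_of_le zero_le_one] at hx
    simp only [abs_of_pos hx.1]
  have h3 : IntervalIntegrable (fun x : ℝ => |x| ^ (-α)) volume (-1) 0 := by
    rw [IntervalIntegrable.iff_comp_neg]
    simpa using h2.symm
  have h4 := h3.trans h2
  rw [intervalIntegrable_iff_integrableOn_Icc_of_le (by norm_num)] at h4
  exact h4.lintegral_lt_top

theorem lintegral_max_one_enorm_inv_rpow_lt_top {β : ℝ} (hβ : 1 < β) :
    ∫⁻ x : ℝ, (max 1 ‖x‖ₑ)⁻¹ ^ β < ∞ := by
  have h1 : Integrable (fun x : ℝ => (1 + ‖x‖) ^ (-β)) :=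
    integrable_one_add_norm (by simpa using hβ)
  have h2 := (h1.const_mul ((2 : ℝ) ^ β)).lintegral_lt_top
  refine lt_of_le_of_lt (lintegral_mono fun x => ?_) h2
  have hm : (max 1 ‖x‖ₑ) = ENNReal.ofReal (max 1 |x|) := by
    rw [Real.enorm_eq_ofReal_abs, ENNReal.ofReal_max, ENNReal.ofReal_one]
  have hpos : 0 < max 1 |x| := lt_max_of_lt_left one_pos
  simp only
  rw [hm, ENNReal.inv_rpow, ← ENNReal.rpow_neg, ENNReal.ofReal_rpow_of_pos hpos]
  refine ENNReal.ofReal_le_ofReal ?_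
  have h3 : (1 + |x|) / 2 ≤ max 1 |x| := by
    have := le_max_left 1 |x|; have := le_max_right 1 |x|; linarith
  have h4 : 0 < (1 + |x|) / 2 := by positivity
  calc (max 1 |x|) ^ (-β) ≤ ((1 + |x|) / 2) ^ (-β) :=
        Real.rpow_le_rpow_of_nonpos h4 h3 (by linarith)
    _ = 2 ^ β * (1 + ‖x‖) ^ (-β) := by
        rw [Real.div_rpow (by positivity) zero_le_two, Real.rpow_neg zero_le_two, div_inv_eq_mul,
          mul_comm, Real.norm_eq_abs]

/-- Substitute `x = R u`: the kernel scales by `R ^ (-β)` and the volume by `R`. -/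
theorem lintegral_max_enorm_inv_rpow {β : ℝ} (hβ : 1 < β) {R : ℝ≥0∞} (hR : R ≠ 0) (hR' : R ≠ ∞) :
    ∫⁻ x : ℝ, (max R ‖x‖ₑ)⁻¹ ^ β =
      R⁻¹ ^ (β - 1) * ∫⁻ x : ℝ, (max 1 ‖x‖ₑ)⁻¹ ^ β := by
  have hr : 0 < R.toReal := ENNReal.toReal_pos hR hR'
  have hRr : ENNReal.ofReal |R.toReal| = R := by
    rw [abs_of_pos hr, ENNReal.ofReal_toReal hR']
  have hmeas : Measurable fun x : ℝ => (max R ‖x‖ₑ)⁻¹ ^ β := by fun_prop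
  conv_lhs => rw [← Real.smul_map_volume_mul_left hr.ne']
  rw [lintegral_smul_measure, lintegral_map hmeas (by fun_prop), hRr, smul_eq_mul]
  have h1 : ∀ x : ℝ, (max R ‖R.toReal * x‖ₑ)⁻¹ ^ β = R⁻¹ ^ β * (max 1 ‖x‖ₑ)⁻¹ ^ β := fun x => by
    have : max R ‖R.toReal * x‖ₑ = R * max 1 ‖x‖ₑ := by
      rw [enorm_mul, Real.enorm_eq_ofReal_abs R.toReal, hRr, mul_max, mul_one]
    rw [this, ENNReal.mul_inv (Or.inl hR) (Or.inl hR'),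
      ENNReal.mul_rpow_of_nonneg _ _ (by linarith)]
  simp_rw [h1]
  rw [lintegral_const_mul _ (by fun_prop), ← mul_assoc]
  congr 1
  have h2 : β = (β - 1) + 1 := by ring
  conv_lhs => rw [h2]
  rw [ENNReal.rpow_add_of_nonneg _ _ (by linarith) zero_le_one, ENNReal.rpow_one, mul_comm,
    mul_assoc, ENNReal.inv_mul_cancel hR hR', mul_one]

/-- The density is at most `(2πv) ^ (-1/2)`, hence at most `v ^ (-1/2)`. -/
theorem gaussianReal_le_smul_volume {v : ℝ≥0} (hv : v ≠ 0) :
    gaussianReal 0 v ≤ (ENNReal.ofReal √(v : ℝ))⁻¹ • (volume : Measure ℝ) := by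
  rw [gaussianReal_of_var_ne_zero _ hv, ← withDensity_const]
  refine withDensity_mono (Eventually.of_forall fun x => ?_)
  have hv' : 0 < (v : ℝ) := by positivity
  rw [← ENNReal.ofReal_inv_of_pos (Real.sqrt_pos.2 hv'), gaussianPDF]
  refine ENNReal.ofReal_le_ofReal ?_
  rw [gaussianPDFReal]
  have h1 : Real.exp (-(x - 0) ^ 2 / (2 * v)) ≤ 1 := by
    rw [Real.exp_le_one_iff]
    exact div_nonpos_of_nonpos_of_nonneg (by simp [sq_nonneg]) (by positivity)
  have h2 : √(v : ℝ) ≤ √(2 * Real.pi * v) := by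
    refine Real.sqrt_le_sqrt ?_
    nlinarith [Real.pi_gt_three]
  calc (√(2 * Real.pi * v))⁻¹ * Real.exp (-(x - 0) ^ 2 / (2 * v))
      ≤ (√(2 * Real.pi * v))⁻¹ * 1 := by gcongr
    _ ≤ (√(v : ℝ))⁻¹ := by
      rw [mul_one]
      exact inv_anti₀ (Real.sqrt_pos.2 hv') h2

theorem gaussianReal_eq_map_sqrt_mul (v : ℝ≥0) :
    gaussianReal 0 v = (gaussianReal 0 1).map (fun x => √(v : ℝ) * x) := by
  rw [gaussianReal_map_const_mul]
  congr 1
  · simp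
  · ext; simp

theorem lintegral_enorm_inv_rpow_gaussianReal_one_lt_top {α : ℝ} (hα0 : 0 ≤ α) (hα : α < 1) :
    ∫⁻ x, ‖x‖ₑ⁻¹ ^ α ∂(gaussianReal 0 1) < ∞ := by
  have hm : MeasurableSet (Icc (-1 : ℝ) 1) := measurableSet_Icc
  rw [← lintegral_add_compl _ hm]
  refine ENNReal.add_lt_top.2 ⟨?_, ?_⟩
  · have h1 := gaussianReal_le_smul_volume (v := 1) one_ne_zero
    simp only [NNReal.coe_one, Real.sqrt_one, ENNReal.ofReal_one, inv_one, one_smul] at h1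
    exact (lintegral_mono' (Measure.restrict_mono le_rfl h1) le_rfl).trans_lt
      (setLIntegral_enorm_inv_rpow_lt_top hα)
  · calc ∫⁻ x in (Icc (-1 : ℝ) 1)ᶜ, ‖x‖ₑ⁻¹ ^ α ∂(gaussianReal 0 1)
        ≤ ∫⁻ x in (Icc (-1 : ℝ) 1)ᶜ, 1 ∂(gaussianReal 0 1) := by
          refine setLIntegral_mono' hm.compl fun x hx => ?_
          refine ENNReal.rpow_le_one ?_ hα0
          rw [ENNReal.inv_le_one, Real.enorm_eq_ofReal_abs, ENNReal.one_le_ofReal]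
          by_contra! hcon
          exact hx (abs_le.1 hcon.le)
      _ < ∞ := by simp

/-- Negative moments of a centered Gaussian variable. -/
theorem lintegral_enorm_inv_rpow_gaussianReal (v : ℝ≥0) (hv : v ≠ 0) {α : ℝ} (hα0 : 0 ≤ α) :
    ∫⁻ x, ‖x‖ₑ⁻¹ ^ α ∂(gaussianReal 0 v) =
      (ENNReal.ofReal √(v : ℝ))⁻¹ ^ α * ∫⁻ x, ‖x‖ₑ⁻¹ ^ α ∂(gaussianReal 0 1) := by
  have hs : 0 < √(v : ℝ) := Real.sqrt_pos.2 (by positivity)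
  rw [gaussianReal_eq_map_sqrt_mul, lintegral_map (by fun_prop) (by fun_prop),
    ← lintegral_const_mul _ (by fun_prop)]
  refine lintegral_congr fun x => ?_
  rw [enorm_mul, Real.enorm_eq_ofReal_abs √(v : ℝ), abs_of_pos hs,
    ENNReal.mul_inv (Or.inl (by simpa using hs)) (Or.inl ENNReal.ofReal_ne_top),
    ENNReal.mul_rpow_of_nonneg _ _ hα0]

/-- One component of the graph kernel: the bounded density costs `v ^ (-1/2)`, and scaling extracts
the power of `R`, which will be the distance in the parameter space. -/
theorem lintegral_max_enorm_inv_rpow_gaussianReal_le (v : ℝ≥0) (hv : v ≠ 0) {β : ℝ} (hβ : 1 < β)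
    {R : ℝ≥0∞} (hR : R ≠ 0) (hR' : R ≠ ∞) :
    ∫⁻ x, (max R ‖x‖ₑ)⁻¹ ^ β ∂(gaussianReal 0 v) ≤
      (ENNReal.ofReal √(v : ℝ))⁻¹ * (R⁻¹ ^ (β - 1) * ∫⁻ x : ℝ, (max 1 ‖x‖ₑ)⁻¹ ^ β) := by
  rw [← lintegral_max_enorm_inv_rpow hβ hR hR', ← smul_eq_mul, ← lintegral_smul_measure]
  exact lintegral_mono' (gaussianReal_le_smul_volume hv) le_rfl

/-- Absolute moments of a centered Gaussian variable. -/
theorem lintegral_enorm_pow_gaussianReal (v : ℝ≥0) (m : ℕ) :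
    ∫⁻ x, ‖x‖ₑ ^ m ∂(gaussianReal 0 v) =
      ENNReal.ofReal √(v : ℝ) ^ m * ∫⁻ x, ‖x‖ₑ ^ m ∂(gaussianReal 0 1) := by
  rw [gaussianReal_eq_map_sqrt_mul, lintegral_map (by fun_prop) (by fun_prop),
    ← lintegral_const_mul _ (by fun_prop)]
  refine lintegral_congr fun x => ?_
  rw [enorm_mul, Real.enorm_eq_ofReal_abs √(v : ℝ), abs_of_nonneg (Real.sqrt_nonneg _), mul_pow]

theorem lintegral_enorm_pow_gaussianReal_one_lt_top (m : ℕ) :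
    ∫⁻ x, ‖x‖ₑ ^ m ∂(gaussianReal 0 1) < ∞ := by
  have h := (memLp_id_gaussianReal (μ := 0) (v := 1) m).integrable_norm_pow'
  have := h.2
  rw [HasFiniteIntegral] at this
  simpa using this

/-! ### Distribution of the exponents over the coordinates. -/

/-- Greedy allocation: a mass `q ≤ ∑ 1 / H j` can be distributed as `∑ a j = q` with
`0 ≤ a j ≤ 1 / H j`, filling the first slots first. -/
theorem exists_greedy_weights {N : ℕ} {H : Fin N → ℝ} (hH : ∀ j, 0 < H j) {q : ℝ} (hq : 0 < q)
    (hqS : q ≤ ∑ j, 1 / H j) :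
    ∃ a : Fin N → ℝ, (∀ j, 0 ≤ a j) ∧ (∀ j, H j * a j ≤ 1) ∧ ∑ j, a j = q ∧
      ∃ k : Fin N, ∑ j, (1 - H j * a j) =
        (∑ j ∈ Finset.Iic k, H k / H j) + ((N : ℝ) - ((k : ℝ) + 1)) - H k * q := by
  classical
  have hne : ∃ k : Fin N, q ≤ ∑ j ∈ Finset.Iic k, 1 / H j := by
    obtain rfl | hN := Nat.eq_zero_or_pos N
    · simp at hqS; linarith
    · refine ⟨⟨N - 1, by omega⟩, ?_⟩
      have : Finset.Iic (⟨N - 1, by omega⟩ : Fin N) = Finset.univ := by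
        ext j
        simp only [Finset.mem_Iic, Finset.mem_univ, iff_true, Fin.le_def]
        omega
      rwa [this]
  -- `k` is the first slot at which the cumulative capacity reaches `q`: slots below `k` are filled,
  -- `k` takes the remainder `q - σ`, later slots stay empty.
  set s : Finset (Fin N) := Finset.univ.filter fun k => q ≤ ∑ j ∈ Finset.Iic k, 1 / H j with hs
  have hsne : s.Nonempty := let ⟨k, hk⟩ := hne; ⟨k, by simpa [hs] using hk⟩
  set k := s.min' hsne with hkdef
  have hk : q ≤ ∑ j ∈ Finset.Iic k, 1 / H j := by
    have := s.min'_mem hsne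
    exact (Finset.mem_filter.1 this).2
  have hIic : Finset.Iic k = insert k (Finset.Iio k) := (Finset.Iio_insert k).symm
  have hlt : ∑ j ∈ Finset.Iio k, 1 / H j < q := by
    by_cases h0 : (k : ℕ) = 0
    · have : Finset.Iio k = ∅ := by
        ext j; simp only [Finset.mem_Iio, Fin.lt_def, Finset.notMem_empty, iff_false]; omega
      simpa [this] using hq
    · by_contra! hcon
      have hk' : (⟨(k : ℕ) - 1, by omega⟩ : Fin N) ∈ s := by
        rw [hs, Finset.mem_filter]
        refine ⟨Finset.mem_univ _, ?_⟩
        have : Finset.Iic (⟨(k : ℕ) - 1, by omega⟩ : Fin N) = Finset.Iio k := by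
          ext j; simp only [Finset.mem_Iic, Finset.mem_Iio, Fin.lt_def, Fin.le_def]; omega
        rwa [this]
      have := s.min'_le _ hk'
      rw [← hkdef, Fin.le_def] at this
      simp only at this; omega
  rw [hIic, Finset.sum_insert (by simp)] at hk
  set σ := ∑ j ∈ Finset.Iio k, 1 / H j with hσ
  set a : Fin N → ℝ := fun j => if j < k then 1 / H j else if j = k then q - σ else 0 with ha
  have hak : a k = q - σ := by simp [ha]
  have hlow : ∀ j ∈ Finset.Iio k, a j = 1 / H j := fun j hj => by
    simp [ha, Finset.mem_Iio.1 hj]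
  have hsplit : ∀ f : Fin N → ℝ, (∀ j, k < j → f j = 0) →
      ∑ j, f j = f k + ∑ j ∈ Finset.Iio k, f j := fun f hf => by
    rw [← Finset.sum_insert (by simp), ← hIic]
    refine (Finset.sum_subset (Finset.subset_univ _) fun j _ hj => hf j ?_).symm
    simpa using hj
  have hhigh : ∀ j, k < j → a j = 0 := fun j hj => by
    simp [ha, hj.ne', hj.not_gt]
  refine ⟨a, fun j => ?_, fun j => ?_, ?_, k, ?_⟩
  · rcases lt_trichotomy j k with h | h | h
    · rw [hlow j (Finset.mem_Iio.2 h)]; exact (one_div_pos.2 (hH j)).le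
    · rw [h, hak]; linarith
    · rw [hhigh j h]
  · rcases lt_trichotomy j k with h | h | h
    · rw [hlow j (Finset.mem_Iio.2 h), mul_one_div_cancel (hH j).ne']
    · rw [h, hak]
      have : H k * (q - σ) ≤ H k * (1 / H k) :=
        mul_le_mul_of_nonneg_left (by linarith) (hH k).le
      rwa [mul_one_div_cancel (hH k).ne'] at this
    · rw [hhigh j h, mul_zero]; exact zero_le_one
  · rw [hsplit a hhigh, Finset.sum_congr rfl hlow, hak]; ring
  · have h1 : ∑ j ∈ Finset.Iio k, H j * a j = ∑ j ∈ Finset.Iio k, (1 : ℝ) :=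
      Finset.sum_congr rfl fun j hj => by rw [hlow j hj, mul_one_div_cancel (hH j).ne']
    have h2 : ∑ j ∈ Finset.Iio k, H k / H j = H k * σ := by
      rw [hσ, Finset.mul_sum]; exact Finset.sum_congr rfl fun j _ => by ring
    rw [Finset.sum_sub_distrib, hsplit (fun j => H j * a j) fun j hj => by simp [hhigh j hj], hak,
      h1, hIic, Finset.sum_insert (by simp), div_self (hH k).ne', h2]
    simp only [Finset.sum_const, Finset.card_univ, Fintype.card_fin, Fin.card_Iio, nsmul_eq_mul,
      mul_one]
    ring

/-- The exponents for the energy of the graph: below the critical value one can split the two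
singular factors of the kernel over the coordinates, with total exponent `< 1` in each. -/
theorem exists_split_exponents {N : ℕ} {H : Fin N → ℝ} (hH : ∀ j, 0 < H j) (hH1 : ∀ j, H j ≤ 1)
    {p γ : ℝ} (hp : 0 < p) (hpγ : p < γ) (hpS : p < ∑ j, 1 / H j)
    (hA : ∀ k : Fin N, γ < (∑ j ∈ Finset.Iic k, H k / H j) + ((N : ℝ) - ((k : ℝ) + 1)) +
      (1 - H k) * p) :
    ∃ a b : Fin N → ℝ, (∀ j, 0 ≤ a j) ∧ (∀ j, 0 ≤ b j) ∧ ∑ j, a j = p ∧ ∑ j, b j = γ - p ∧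
      ∀ j, H j * a j + b j < 1 := by
  -- The strict inequalities leave room for a factor `μ > 1`. Allocating the mass `p * μ` and then
  -- dividing by `μ` makes the final coordinate bounds strict.
  obtain ⟨μ, hμ1, hμS, hμA⟩ : ∃ μ : ℝ, 1 < μ ∧ p * μ ≤ ∑ j, 1 / H j ∧
      ∀ k : Fin N, γ * μ ≤ (∑ j ∈ Finset.Iic k, H k / H j) + ((N : ℝ) - ((k : ℝ) + 1)) +
        (1 - H k) * p := by
    have hcont : ∀ x : ℝ, Tendsto (fun μ : ℝ => x * μ) (𝓝[>] 1) (𝓝 x) := fun x => by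
      have : Tendsto (fun μ : ℝ => x * μ) (𝓝 1) (𝓝 (x * 1)) := (continuous_const_mul x).tendsto 1
      rw [mul_one] at this
      exact this.mono_left nhdsWithin_le_nhds
    have h1 := (hcont p).eventually (Iio_mem_nhds hpS)
    have h2 := eventually_all.2 fun k => (hcont γ).eventually (Iio_mem_nhds (hA k))
    obtain ⟨μ, ⟨h1, h2⟩, h3⟩ := ((h1.and h2).and self_mem_nhdsWithin).exists
    exact ⟨μ, h3, le_of_lt h1, fun k => le_of_lt (h2 k)⟩
  have hμ0 : 0 < μ := one_pos.trans hμ1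
  obtain ⟨a, ha0, ha1, hap, k, hk⟩ := exists_greedy_weights hH (mul_pos hp hμ0) hμS
  set c : Fin N → ℝ := fun j => 1 - H j * a j with hc
  have hc0 : ∀ j, 0 ≤ c j := fun j => sub_nonneg.2 (ha1 j)
  have hsum : (γ - p) * μ ≤ ∑ j, c j := by
    rw [hk]
    have := hμA k
    have h1 : H k * (p * (μ - 1)) ≤ 1 * (p * (μ - 1)) :=
      mul_le_mul_of_nonneg_right (hH1 k) (mul_nonneg hp.le (by linarith))
    nlinarith
  have hγp : 0 < γ - p := by linarith
  have hsum0 : 0 < ∑ j, c j := (mul_pos hγp hμ0).trans_le hsum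
  -- The second exponent is shared in proportion to the room `c j` left by the first; since `∑ c j ≥
  -- (γ - p) μ`, each coordinate total is at most `(H j * a j + c j) / μ = 1 / μ`.
  refine ⟨fun j => a j / μ, fun j => c j * ((γ - p) / ∑ j, c j), fun j => div_nonneg (ha0 j) hμ0.le,
    fun j => mul_nonneg (hc0 j) (div_nonneg hγp.le hsum0.le), ?_, ?_, fun j => ?_⟩
  · rw [← Finset.sum_div, hap, mul_div_cancel_right₀ _ hμ0.ne']
  · rw [← Finset.sum_mul, mul_div_cancel₀ _ hsum0.ne']
  · have h1 : (γ - p) / ∑ j, c j ≤ 1 / μ := by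
      rw [div_le_div_iff₀ hsum0 hμ0]; linarith
    calc H j * (a j / μ) + c j * ((γ - p) / ∑ j, c j)
        ≤ H j * (a j / μ) + c j * (1 / μ) := by
          have := mul_le_mul_of_nonneg_left h1 (hc0 j); linarith
      _ = 1 / μ := by rw [hc]; field_simp; ring
      _ < 1 := by rw [div_lt_one hμ0]; exact hμ1

/-! ### Regular fields and the expected-energy criterion. -/

/-- A continuous measurable `ℝ^p`-valued field on `[0,1]^N` (in sup-norm coordinates) whose
increments have i.i.d. centered Gaussian components, with variance comparable to the anisotropic
variogram. -/
structure IsRegularGaussianField {N p : ℕ} {Ω : Type*} [MeasurableSpace Ω]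
    (Y : (Fin N → ℝ) → Ω → Fin p → ℝ) (P : Measure Ω) (H : Fin N → ℝ) : Prop where
  continuous : ∀ ω, Continuous fun t => Y t ω
  measurable : ∀ t, Measurable (Y t)
  increments : ∃ δ : ℝ, 0 < δ ∧ ∃ c : ℝ, 1 ≤ c ∧ ∀ s ∈ Icc (0 : Fin N → ℝ) 1,
    ∀ t ∈ Icc (0 : Fin N → ℝ) 1, (∀ j, |s j - t j| ≤ δ) → ∃ v : ℝ≥0,
      c⁻¹ * ∑ j, |s j - t j| ^ (2 * H j) ≤ v ∧ v ≤ c * ∑ j, |s j - t j| ^ (2 * H j) ∧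
      (∀ i, P.map (fun ω => Y t ω i - Y s ω i) = gaussianReal 0 v) ∧
      iIndepFun (fun i ω => Y t ω i - Y s ω i) P

/-- Each `M⁻¹` is at most `(x i)⁻¹`. This turns a power of a norm or of a standard deviation into a
product of one-dimensional kernels, with a free choice of how the exponent is shared. -/
theorem inv_rpow_sum_le_prod {ι : Type*} (I : Finset ι) {M : ℝ≥0∞} {x : ι → ℝ≥0∞} {a : ι → ℝ}
    (hx : ∀ i ∈ I, x i ≤ M) (ha : ∀ i ∈ I, 0 ≤ a i) :
    M⁻¹ ^ (∑ i ∈ I, a i) ≤ ∏ i ∈ I, (x i)⁻¹ ^ a i := by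
  induction I using Finset.cons_induction with
  | empty => simp
  | cons i I hi ih =>
    have h1 : ∀ j ∈ I, x j ≤ M := fun j hj => hx j (Finset.mem_cons_of_mem hj)
    have h2 : ∀ j ∈ I, 0 ≤ a j := fun j hj => ha j (Finset.mem_cons_of_mem hj)
    have hi' := Finset.mem_cons_self i I (h := hi)
    rw [Finset.sum_cons, Finset.prod_cons,
      ENNReal.rpow_add_of_nonneg _ _ (ha i hi') (Finset.sum_nonneg h2)]
    exact mul_le_mul' (ENNReal.rpow_le_rpow (ENNReal.inv_le_inv.2 (hx i hi')) (ha i hi')) (ih h1 h2)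

theorem lintegral_pi_prod_eq_prod {N : ℕ} (τ : Measure ℝ) [IsProbabilityMeasure τ]
    (f : Fin N → ℝ → ℝ≥0∞) (hf : ∀ j, Measurable (f j)) :
    ∫⁻ t, ∏ j, f j (t j) ∂(Measure.pi fun _ : Fin N => τ) = ∏ j, ∫⁻ x, f j x ∂τ := by
  rw [lintegral_prod_eq_prod_lintegral_of_indepFun Finset.univ (fun j (t : Fin N → ℝ) => f j (t j))
    (iIndepFun_pi fun j => (hf j).aemeasurable) fun j => (hf j).comp (measurable_pi_apply j)]
  refine Finset.prod_congr rfl fun j _ => ?_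
  exact (measurePreserving_eval (fun _ : Fin N => τ) j).lintegral_comp (hf j)

theorem lintegral_prod_of_iIndepFun_map_eq {p : ℕ} {Ω : Type*} [MeasurableSpace Ω]
    {P : Measure Ω} {Z : Fin p → Ω → ℝ} (hZ : ∀ i, Measurable (Z i)) (hind : iIndepFun Z P)
    {μ : Measure ℝ} (hlaw : ∀ i, P.map (Z i) = μ) {f : ℝ → ℝ≥0∞} (hf : Measurable f) :
    ∫⁻ ω, ∏ i, f (Z i ω) ∂P = (∫⁻ x, f x ∂μ) ^ p := by
  rw [lintegral_prod_eq_prod_lintegral_of_indepFun Finset.univ (fun i ω => f (Z i ω))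
    (hind.comp (fun _ => f) fun _ => hf) fun i => hf.comp (hZ i)]
  have h : ∀ i, ∫⁻ ω, f (Z i ω) ∂P = ∫⁻ x, f x ∂μ := fun i => by
    rw [← hlaw i, lintegral_map hf (hZ i)]
  simp [h]

/-- The uniform probability measure on `[0, η]`. -/
noncomputable def uniformIcc (η : ℝ) : Measure ℝ :=
  (ENNReal.ofReal η)⁻¹ • volume.restrict (Icc 0 η)

theorem isProbabilityMeasure_uniformIcc {η : ℝ} (hη : 0 < η) :
    IsProbabilityMeasure (uniformIcc η) := by
  constructor
  simp only [uniformIcc, Measure.smul_apply, Measure.restrict_apply MeasurableSet.univ, univ_inter,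
    Real.volume_Icc, sub_zero, smul_eq_mul]
  exact ENNReal.inv_mul_cancel (by simpa using hη) ENNReal.ofReal_ne_top

/-- After translation by `s` the variable stays in `[-1, 1]`, so the bound is uniform in `s`. -/
theorem lintegral_uniformIcc_le {η : ℝ} (hη1 : η ≤ 1) {s : ℝ} (hs : s ∈ Icc (0 : ℝ) 1)
    (e : ℝ) : ∫⁻ t, ‖s - t‖ₑ⁻¹ ^ e ∂(uniformIcc η) ≤
      (ENNReal.ofReal η)⁻¹ * ∫⁻ u in Icc (-1 : ℝ) 1, ‖u‖ₑ⁻¹ ^ e := by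
  rw [uniformIcc, lintegral_smul_measure, smul_eq_mul]
  refine mul_le_mul' le_rfl ?_
  rw [← lintegral_indicator measurableSet_Icc, ← lintegral_indicator measurableSet_Icc,
    ← lintegral_sub_left_eq_self ((Icc (-1 : ℝ) 1).indicator fun u => ‖u‖ₑ⁻¹ ^ e) s]
  refine lintegral_mono fun t => ?_
  by_cases ht : t ∈ Icc 0 η
  · rw [indicator_of_mem ht, indicator_of_mem]
    exact ⟨by linarith [hs.1, ht.2], by linarith [hs.2, ht.1]⟩
  · simp [indicator_of_notMem ht]

theorem ae_pi_uniformIcc {N : ℕ} {η : ℝ} (hη : 0 < η) (s : Fin N → ℝ) :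
    ∀ᵐ t ∂(Measure.pi fun _ : Fin N => uniformIcc η), ∀ j, t j ∈ Icc 0 η ∧ s j ≠ t j := by
  have := isProbabilityMeasure_uniformIcc hη
  rw [ae_all_iff]
  intro j
  have h : ∀ᵐ x ∂(uniformIcc η), x ∈ Icc 0 η ∧ s j ≠ x := by
    refine Measure.ae_smul_measure ?_ _
    refine (ae_restrict_mem measurableSet_Icc).and (ae_restrict_of_ae ?_)
    have : ∀ᵐ x : ℝ, x ∈ ({s j} : Set ℝ)ᶜ := compl_mem_ae_iff.2 (by simp)
    filter_upwards [this] with x hx using fun h => hx h.symm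
  exact (measurePreserving_eval (fun _ : Fin N => uniformIcc η) j).quasiMeasurePreserving.ae h

/-- Energy method for a random field: a bound on expected kernels by an integrable product kernel
gives an almost sure lower bound on the dimension of the image. -/
theorem ae_le_dimH_image_of_kernel_le {N : ℕ} {Ω Z : Type*} [MeasurableSpace Ω] {P : Measure Ω}
    [IsProbabilityMeasure P] [MetricSpace Z] [MeasurableSpace Z] [BorelSpace Z]
    [SecondCountableTopology Z] {F : (Fin N → ℝ) → Ω → Z} (hFc : ∀ ω, Continuous fun t => F t ω)
    (hFm : ∀ t, Measurable (F t)) {γ : ℝ≥0} {e : Fin N → ℝ} (he : ∀ j, e j < 1) {η : ℝ}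
    (hη : 0 < η) (hη1 : η ≤ 1) {C : ℝ≥0∞} (hC : C ≠ ∞)
    (hK : ∀ s ∈ Icc (0 : Fin N → ℝ) 1, ∀ t ∈ Icc (0 : Fin N → ℝ) 1, (∀ j, |s j - t j| ≤ η) →
      (∀ j, s j ≠ t j) →
      ∫⁻ ω, (edist (F s ω) (F t ω))⁻¹ ^ (γ : ℝ) ∂P ≤ C * ∏ j, ‖s j - t j‖ₑ⁻¹ ^ e j) :
    ∀ᵐ ω ∂P, (γ : ℝ≥0∞) ≤ dimH ((fun t => F t ω) '' Icc (0 : Fin N → ℝ) 1) := by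
  have := isProbabilityMeasure_uniformIcc hη
  set ν := Measure.pi fun _ : Fin N => uniformIcc η with hν
  have hFu : Measurable (Function.uncurry F) :=
    measurable_uncurry_of_continuous_of_measurable hFc hFm
  have hKm : Measurable fun z : Ω × ((Fin N → ℝ) × (Fin N → ℝ)) =>
      (edist (F z.2.1 z.1) (F z.2.2 z.1))⁻¹ ^ (γ : ℝ) := by
    have h1 : Measurable fun z : Ω × ((Fin N → ℝ) × (Fin N → ℝ)) => F z.2.1 z.1 :=
      hFu.comp (by fun_prop : Measurable fun z : Ω × ((Fin N → ℝ) × (Fin N → ℝ)) => (z.2.1, z.1))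
    have h2 : Measurable fun z : Ω × ((Fin N → ℝ) × (Fin N → ℝ)) => F z.2.2 z.1 :=
      hFu.comp (by fun_prop : Measurable fun z : Ω × ((Fin N → ℝ) × (Fin N → ℝ)) => (z.2.2, z.1))
    exact ((h1.edist h2).inv).pow_const _
  have hmem : ∀ t : Fin N → ℝ, (∀ j, t j ∈ Icc 0 η) → t ∈ Icc (0 : Fin N → ℝ) 1 := fun t ht =>
    ⟨fun j => (ht j).1, fun j => (ht j).2.trans hη1⟩
  have hdist : ∀ s t : Fin N → ℝ, (∀ j, s j ∈ Icc 0 η) → (∀ j, t j ∈ Icc 0 η) →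
      ∀ j, |s j - t j| ≤ η := fun s t hs ht j => by
    rw [abs_le]; constructor <;> linarith [(hs j).1, (hs j).2, (ht j).1, (ht j).2]
  set L : ℝ≥0∞ := C * ∏ j, ((ENNReal.ofReal η)⁻¹ * ∫⁻ u in Icc (-1 : ℝ) 1, ‖u‖ₑ⁻¹ ^ e j) with hL
  have hLt : L ≠ ∞ := by
    refine ENNReal.mul_ne_top hC (ENNReal.prod_ne_top fun j _ => ENNReal.mul_ne_top ?_
      (setLIntegral_enorm_inv_rpow_lt_top (he j)).ne)
    simpa using hη
  have hfib : ∀ s : Fin N → ℝ, (∀ j, s j ∈ Icc 0 η) →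
      ∫⁻ t, ∫⁻ ω, (edist (F s ω) (F t ω))⁻¹ ^ (γ : ℝ) ∂P ∂ν ≤ L := fun s hs => by
    calc ∫⁻ t, ∫⁻ ω, (edist (F s ω) (F t ω))⁻¹ ^ (γ : ℝ) ∂P ∂ν
        ≤ ∫⁻ t, C * ∏ j, ‖s j - t j‖ₑ⁻¹ ^ e j ∂ν := by
          refine lintegral_mono_ae ?_
          filter_upwards [ae_pi_uniformIcc hη s] with t ht
          exact hK s (hmem s hs) t (hmem t fun j => (ht j).1) (hdist s t hs fun j => (ht j).1)
            fun j => (ht j).2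
      _ = C * ∏ j, ∫⁻ x, ‖s j - x‖ₑ⁻¹ ^ e j ∂(uniformIcc η) := by
          rw [lintegral_const_mul _ (by fun_prop),
            lintegral_pi_prod_eq_prod (uniformIcc η) (fun j x => ‖s j - x‖ₑ⁻¹ ^ e j)
              fun j => by fun_prop]
      _ ≤ L := by
          refine mul_le_mul_right (Finset.prod_le_prod' fun j _ => ?_) _
          exact lintegral_uniformIcc_le hη1 ((hmem s hs).1 j |> fun h => ⟨h, (hmem s hs).2 j⟩) _
  -- By Tonelli the expected energy is the double integral of the expected kernel, which `hfib`
  -- bounds; the energy is then finite for almost every `ω`.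
  have hE : ∫⁻ ω, ∫⁻ z : (Fin N → ℝ) × (Fin N → ℝ),
      (edist (F z.1 ω) (F z.2 ω))⁻¹ ^ (γ : ℝ) ∂(ν.prod ν) ∂P ≠ ∞ := by
    rw [lintegral_lintegral_swap hKm.aemeasurable]
    rw [lintegral_prod _ (Measurable.aemeasurable (Measurable.lintegral_prod_left' hKm))]
    refine ne_top_of_le_ne_top hLt ?_
    calc ∫⁻ s, ∫⁻ t, ∫⁻ ω, (edist (F s ω) (F t ω))⁻¹ ^ (γ : ℝ) ∂P ∂ν ∂ν ≤ ∫⁻ s, L ∂ν := by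
          refine lintegral_mono_ae ?_
          filter_upwards [ae_pi_uniformIcc hη 0] with s hs
          exact hfib s fun j => (hs j).1
      _ = L := by simp
  filter_upwards [ae_lt_top hKm.lintegral_prod_right' hE] with ω hω
  have hFω : Measurable fun t => F t ω := (hFc ω).measurable
  refine le_dimH_of_energy_ne_top (ν.map fun t => F t ω) ?_ ?_
  · intro h0
    -- `Measure.le_map_apply` requires no measurability of the image set.
    have h1 := measure_eq_zero_iff_ae_notMem.1
      (le_antisymm ((Measure.le_map_apply hFω.aemeasurable _).trans h0.le) zero_le)
    obtain ⟨t, ht, ht'⟩ := ((ae_pi_uniformIcc hη 0).and h1).exists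
    exact ht' ⟨t, hmem t fun j => (ht j).1, rfl⟩
  · have hm2 : Measurable fun z : Z × Z => (edist z.1 z.2)⁻¹ ^ (γ : ℝ) := by fun_prop
    rw [lintegral_map hm2.lintegral_prod_right' hFω]
    have : ∀ s, ∫⁻ y, (edist (F s ω) y)⁻¹ ^ (γ : ℝ) ∂(ν.map fun t => F t ω) =
        ∫⁻ t, (edist (F s ω) (F t ω))⁻¹ ^ (γ : ℝ) ∂ν := fun s => by
      rw [lintegral_map (by fun_prop) hFω]
    simp_rw [this]
    rw [lintegral_prod _ (by exact (hKm.comp measurable_prodMk_left).aemeasurable)] at hω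
    exact hω.ne

/-- Lower bounds on `√v` turn into product bounds on its negative powers. -/
theorem inv_sqrt_rpow_le_prod {N : ℕ} {H : Fin N → ℝ} {c : ℝ} (hc : 1 ≤ c)
    {s t : Fin N → ℝ} {v : ℝ≥0} (hv : c⁻¹ * ∑ j, |s j - t j| ^ (2 * H j) ≤ v)
    (hst : ∀ j, s j ≠ t j) {a : Fin N → ℝ} (ha : ∀ j, 0 ≤ a j) :
    (ENNReal.ofReal √(v : ℝ))⁻¹ ^ (∑ j, a j) ≤
      ∏ j, (ENNReal.ofReal √c⁻¹)⁻¹ ^ a j * ‖s j - t j‖ₑ⁻¹ ^ (H j * a j) := by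
  have hc0 : 0 < √c⁻¹ := Real.sqrt_pos.2 (by positivity)
  -- A single summand of the variogram already gives `√c⁻¹ * |s j - t j| ^ H j ≤ √v`.
  refine (inv_rpow_sum_le_prod Finset.univ (x := fun j => ENNReal.ofReal √c⁻¹ *
    ‖s j - t j‖ₑ ^ H j) (fun j _ => ?_) fun j _ => ha j).trans
    (Finset.prod_le_prod' fun j _ => ?_)
  · have h0 : 0 < |s j - t j| := abs_pos.2 (sub_ne_zero.2 (hst j))
    rw [Real.enorm_eq_ofReal_abs, ENNReal.ofReal_rpow_of_pos h0, ← ENNReal.ofReal_mul hc0.le]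
    refine ENNReal.ofReal_le_ofReal (Real.le_sqrt_of_sq_le (le_trans ?_ hv))
    rw [mul_pow, Real.sq_sqrt (by positivity), ← Real.rpow_natCast, ← Real.rpow_mul h0.le]
    refine mul_le_mul_of_nonneg_left ?_ (by positivity)
    rw [mul_comm (H j)]
    exact Finset.single_le_sum (f := fun j => |s j - t j| ^ (2 * H j))
      (fun i _ => Real.rpow_nonneg (abs_nonneg _) _) (Finset.mem_univ j)
  · rw [ENNReal.mul_inv (Or.inl (by simpa using hc0)) (Or.inl ENNReal.ofReal_ne_top),
      ENNReal.mul_rpow_of_nonneg _ _ (ha j), ENNReal.rpow_mul, ← ENNReal.inv_rpow]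

/-! ### Almost sure lower bounds by energy. -/

section LowerBounds

variable {N p : ℕ} {Ω : Type*} [MeasurableSpace Ω] {P : Measure Ω}
  {Y : (Fin N → ℝ) → Ω → Fin p → ℝ} {H : Fin N → ℝ}

theorem IsRegularGaussianField.measurable_sub (hY : IsRegularGaussianField Y P H)
    (s t : Fin N → ℝ) (i : Fin p) : Measurable fun ω => Y t ω i - Y s ω i :=
  ((measurable_pi_apply i).comp (hY.measurable t)).sub
    ((measurable_pi_apply i).comp (hY.measurable s))

theorem ne_zero_of_variogram_le {c : ℝ} (hc : 1 ≤ c) (hN : 1 ≤ N) {s t : Fin N → ℝ}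
    {v : ℝ≥0} (hv : c⁻¹ * ∑ j, |s j - t j| ^ (2 * H j) ≤ v) (hst : ∀ j, s j ≠ t j) : v ≠ 0 := by
  rintro rfl
  have hne : (Finset.univ : Finset (Fin N)).Nonempty := ⟨⟨0, hN⟩, Finset.mem_univ _⟩
  have : 0 < c⁻¹ * ∑ j, |s j - t j| ^ (2 * H j) :=
    mul_pos (by positivity) (Finset.sum_pos (fun j _ =>
      Real.rpow_pos_of_pos (abs_pos.2 (sub_ne_zero.2 (hst j))) _) hne)
  simp only [NNReal.coe_zero] at hv
  linarith

/-- Almost sure lower bound for the dimension of the image. -/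
theorem IsRegularGaussianField.ae_le_dimH_image [IsProbabilityMeasure P]
    (hY : IsRegularGaussianField Y P H) (hN : 1 ≤ N)
    (hp : 1 ≤ p) (hH : ∀ j, 0 < H j) {γ : ℝ≥0} (hγp : (γ : ℝ) < p)
    (hγS : (γ : ℝ) < ∑ j, 1 / H j) :
    ∀ᵐ ω ∂P, (γ : ℝ≥0∞) ≤ dimH ((fun t => Y t ω) '' Icc (0 : Fin N → ℝ) 1) := by
  obtain ⟨δ, hδ, c, hc, hinc⟩ := hY.increments
  have hp0 : (0 : ℝ) < p := by exact_mod_cast hp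
  set S := ∑ j, 1 / H j with hS
  have hS0 : 0 < S := γ.2.trans_lt hγS
  -- Proportional to `1 / H j`, so that every coordinate exponent `H j * a j` equals `γ / S < 1`.
  set a : Fin N → ℝ := fun j => γ / S * (1 / H j) with ha
  have ha0 : ∀ j, 0 ≤ a j := fun j => by have := hH j; positivity
  have hasum : ∑ j, a j = γ := by
    rw [ha, ← Finset.mul_sum, ← hS, div_mul_cancel₀ _ hS0.ne']
  -- The sup norm dominates each of the `p` independent components, so each carries the power `γ / p
  -- < 1`, whose Gaussian negative moment is finite.
  set α : ℝ := γ / p with hα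
  have hα0 : 0 ≤ α := div_nonneg γ.2 hp0.le
  have hα1 : α < 1 := by rwa [hα, div_lt_one hp0]
  have hαp : α * p = γ := div_mul_cancel₀ _ hp0.ne'
  set G := ∫⁻ x, ‖x‖ₑ⁻¹ ^ α ∂(gaussianReal 0 1) with hG
  have hGt : G ≠ ∞ := (lintegral_enorm_inv_rpow_gaussianReal_one_lt_top hα0 hα1).ne
  set κ := (ENNReal.ofReal √c⁻¹)⁻¹ with hκ
  have hκt : κ ≠ ∞ := by
    have : 0 < √c⁻¹ := Real.sqrt_pos.2 (by positivity)
    simpa [hκ] using this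
  refine ae_le_dimH_image_of_kernel_le hY.continuous hY.measurable (e := fun j => H j * a j)
    (fun j => ?_) (lt_min hδ one_pos) (min_le_right _ _) (C := G ^ p * ∏ j, κ ^ a j) ?_ ?_
  · simp only [ha]
    rw [show H j * (γ / S * (1 / H j)) = γ / S by have := (hH j).ne'; field_simp,
      div_lt_one hS0]
    exact hγS
  · exact ENNReal.mul_ne_top (ENNReal.pow_ne_top hGt)
      (ENNReal.prod_ne_top fun j _ => ENNReal.rpow_ne_top_of_nonneg (ha0 j) hκt)
  intro s hs t ht hst hne
  obtain ⟨v, hv1, -, hlaw, hind⟩ := hinc s hs t ht fun j => (hst j).trans (min_le_left _ _)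
  have hv0 : v ≠ 0 := ne_zero_of_variogram_le hc hN hv1 hne
  calc ∫⁻ ω, (edist (Y s ω) (Y t ω))⁻¹ ^ (γ : ℝ) ∂P
      ≤ ∫⁻ ω, ∏ i, ‖Y t ω i - Y s ω i‖ₑ⁻¹ ^ α ∂P := by
        refine lintegral_mono fun ω => ?_
        have h1 : ∑ _i : Fin p, α = γ := by simp [← hαp, mul_comm]
        simp only
        rw [← h1]
        refine inv_rpow_sum_le_prod _ (fun i _ => ?_) fun _ _ => hα0
        rw [← edist_eq_enorm_sub, edist_comm]
        exact edist_le_pi_edist (Y s ω) (Y t ω) i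
    _ = ((ENNReal.ofReal √(v : ℝ))⁻¹ ^ α * G) ^ p := by
        rw [lintegral_prod_of_iIndepFun_map_eq (hY.measurable_sub s t) hind hlaw
          (f := fun x => ‖x‖ₑ⁻¹ ^ α) (by fun_prop),
          lintegral_enorm_inv_rpow_gaussianReal v hv0 hα0]
    _ = G ^ p * (ENNReal.ofReal √(v : ℝ))⁻¹ ^ (∑ j, a j) := by
        rw [mul_pow, mul_comm, hasum, ← hαp, ENNReal.rpow_mul, ENNReal.rpow_natCast]
    _ ≤ G ^ p * ∏ j, κ ^ a j * ‖s j - t j‖ₑ⁻¹ ^ (H j * a j) :=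
        mul_le_mul' le_rfl (inv_sqrt_rpow_le_prod hc hv1 hne ha0)
    _ = _ := by rw [Finset.prod_mul_distrib, mul_assoc]

/-- Almost sure lower bound for the dimension of the graph, above the dimension `p` of the
target. -/
theorem IsRegularGaussianField.ae_le_dimH_graph [IsProbabilityMeasure P]
    (hY : IsRegularGaussianField Y P H) (hN : 1 ≤ N)
    (hp : 1 ≤ p) (hH : ∀ j, 0 < H j) (hH1 : ∀ j, H j ≤ 1) {γ : ℝ≥0} (hpγ : (p : ℝ) < γ)
    (hpS : (p : ℝ) < ∑ j, 1 / H j)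
    (hA : ∀ k : Fin N, (γ : ℝ) < (∑ j ∈ Finset.Iic k, H k / H j) + ((N : ℝ) - ((k : ℝ) + 1)) +
      (1 - H k) * p) :
    ∀ᵐ ω ∂P, (γ : ℝ≥0∞) ≤ dimH ((fun t => (t, Y t ω)) '' Icc (0 : Fin N → ℝ) 1) := by
  obtain ⟨δ, hδ, c, hc, hinc⟩ := hY.increments
  have hp0 : (0 : ℝ) < p := by exact_mod_cast hp
  obtain ⟨a, b, ha0, hb0, hasum, hbsum, hab⟩ := exists_split_exponents hH hH1 hp0 hpγ hpS hA
  -- Here `β > 1`, so the kernel of each component is integrable at infinity; its `p`-th power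
  -- yields `σ ^ (-p) * R ^ (-(γ - p))` with `R = edist s t`, matching `∑ a j = p` and `∑ b j = γ -
  -- p`.
  set β : ℝ := γ / p with hβ
  have hβ1 : 1 < β := by rwa [hβ, one_lt_div hp0]
  have hβp : β * p = γ := div_mul_cancel₀ _ hp0.ne'
  set G := ∫⁻ x : ℝ, (max 1 ‖x‖ₑ)⁻¹ ^ β with hG
  have hGt : G ≠ ∞ := (lintegral_max_one_enorm_inv_rpow_lt_top hβ1).ne
  set κ := (ENNReal.ofReal √c⁻¹)⁻¹ with hκ
  have hκt : κ ≠ ∞ := by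
    have : 0 < √c⁻¹ := Real.sqrt_pos.2 (by positivity)
    simpa [hκ] using this
  refine ae_le_dimH_image_of_kernel_le (F := fun t ω => (t, Y t ω))
    (fun ω => continuous_id.prodMk (hY.continuous ω)) (fun t => measurable_const.prodMk
      (hY.measurable t)) hab (lt_min hδ one_pos) (min_le_right _ _)
    (C := G ^ p * ∏ j, κ ^ a j) ?_ ?_
  · exact ENNReal.mul_ne_top (ENNReal.pow_ne_top hGt)
      (ENNReal.prod_ne_top fun j _ => ENNReal.rpow_ne_top_of_nonneg (ha0 j) hκt)
  intro s hs t ht hst hne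
  obtain ⟨v, hv1, -, hlaw, hind⟩ := hinc s hs t ht fun j => (hst j).trans (min_le_left _ _)
  have hv0 : v ≠ 0 := ne_zero_of_variogram_le hc hN hv1 hne
  have hR0 : edist s t ≠ 0 := fun h => hne ⟨0, hN⟩ (congrFun (edist_eq_zero.1 h) _)
  have hRt : edist s t ≠ ∞ := edist_ne_top s t
  calc ∫⁻ ω, (edist (s, Y s ω) (t, Y t ω))⁻¹ ^ (γ : ℝ) ∂P
      ≤ ∫⁻ ω, ∏ i, (max (edist s t) ‖Y t ω i - Y s ω i‖ₑ)⁻¹ ^ β ∂P := by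
        refine lintegral_mono fun ω => ?_
        have h1 : ∑ _i : Fin p, β = γ := by simp [← hβp, mul_comm]
        simp only
        rw [← h1]
        refine inv_rpow_sum_le_prod _ (fun i _ => ?_) fun _ _ => by linarith
        rw [← edist_eq_enorm_sub, edist_comm (Y t ω i), Prod.edist_eq]
        exact max_le_max le_rfl (edist_le_pi_edist (Y s ω) (Y t ω) i)
    _ ≤ ((ENNReal.ofReal √(v : ℝ))⁻¹ * ((edist s t)⁻¹ ^ (β - 1) * G)) ^ p := by
        rw [lintegral_prod_of_iIndepFun_map_eq (hY.measurable_sub s t) hind hlaw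
          (f := fun x => (max (edist s t) ‖x‖ₑ)⁻¹ ^ β) (by fun_prop)]
        exact pow_le_pow_left' (lintegral_max_enorm_inv_rpow_gaussianReal_le v hv0 hβ1 hR0 hRt) p
    _ = G ^ p * ((ENNReal.ofReal √(v : ℝ))⁻¹ ^ (∑ j, a j) * (edist s t)⁻¹ ^ (∑ j, b j)) := by
        rw [mul_pow, mul_pow, hasum, hbsum, ← hβp, show β * p - p = (β - 1) * p by ring,
          ENNReal.rpow_mul, ENNReal.rpow_natCast, ENNReal.rpow_natCast]
        ring
    _ ≤ G ^ p * ((∏ j, κ ^ a j * ‖s j - t j‖ₑ⁻¹ ^ (H j * a j)) *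
          ∏ j, ‖s j - t j‖ₑ⁻¹ ^ b j) := by
        refine mul_le_mul' le_rfl (mul_le_mul' (inv_sqrt_rpow_le_prod hc hv1 hne ha0)
          (inv_rpow_sum_le_prod _ (fun j _ => ?_) fun j _ => hb0 j))
        rw [← edist_eq_enorm_sub]
        exact edist_le_pi_edist s t j
    _ = _ := by
        rw [Finset.prod_mul_distrib, mul_assoc, ← Finset.prod_mul_distrib, mul_assoc]
        congr 2
        refine Finset.prod_congr rfl fun j _ => ?_
        rw [ENNReal.rpow_add_of_nonneg _ _ (mul_nonneg (hH j).le (ha0 j)) (hb0 j)]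

end LowerBounds

/-! ### Chaining and the almost sure modulus of continuity. -/

section Chaining

variable {N p : ℕ} {Ω : Type*} [MeasurableSpace Ω] {P : Measure Ω}
  {Y : (Fin N → ℝ) → Ω → Fin p → ℝ} {H : Fin N → ℝ}

/-- The points of `[0,1]^N` whose coordinates are multiples of the step sizes `δ j`. -/
noncomputable def gridPoints {N : ℕ} (δ : Fin N → ℝ) : Finset (Fin N → ℝ) :=
  (Fintype.piFinset fun j => Finset.range (⌊1 / δ j⌋₊ + 1)).image fun z j => (z j : ℝ) * δ j

/-- The grid point at the lower corner of the cell of `t`. -/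
noncomputable def gridFloor {N : ℕ} (δ : Fin N → ℝ) (t : Fin N → ℝ) : Fin N → ℝ :=
  fun j => (⌊t j / δ j⌋₊ : ℝ) * δ j

theorem mem_Icc_of_mem_gridPoints {δ : Fin N → ℝ} (hδ : ∀ j, 0 < δ j) {u : Fin N → ℝ}
    (hu : u ∈ gridPoints δ) : u ∈ Icc (0 : Fin N → ℝ) 1 := by
  obtain ⟨z, hz, rfl⟩ := Finset.mem_image.1 hu
  refine ⟨fun j => mul_nonneg (Nat.cast_nonneg _) (hδ j).le, fun j => ?_⟩
  have h1 : z j ≤ ⌊1 / δ j⌋₊ := by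
    have := Finset.mem_range.1 (Fintype.mem_piFinset.1 hz j); omega
  have h2 : (z j : ℝ) ≤ 1 / δ j := (Nat.le_floor_iff (one_div_nonneg.2 (hδ j).le)).1 h1
  rwa [le_div_iff₀ (hδ j)] at h2

theorem gridFloor_mem_gridPoints {δ : Fin N → ℝ} (hδ : ∀ j, 0 < δ j) {t : Fin N → ℝ}
    (ht : t ∈ Icc (0 : Fin N → ℝ) 1) : gridFloor δ t ∈ gridPoints δ := by
  refine Finset.mem_image.2 ⟨fun j => ⌊t j / δ j⌋₊, Fintype.mem_piFinset.2 fun j => ?_, rfl⟩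
  rw [Finset.mem_range, Nat.lt_succ_iff]
  exact Nat.floor_le_floor (div_le_div_of_nonneg_right (ht.2 j) (hδ j).le)

theorem gridFloor_bounds {δ : Fin N → ℝ} (hδ : ∀ j, 0 < δ j) {t : Fin N → ℝ}
    (ht : t ∈ Icc (0 : Fin N → ℝ) 1) (j : Fin N) :
    gridFloor δ t j ≤ t j ∧ t j ≤ gridFloor δ t j + δ j := by
  have h1 := Nat.floor_le (div_nonneg (ht.1 j) (hδ j).le)
  have h2 := (Nat.lt_floor_add_one (t j / δ j)).le
  rw [le_div_iff₀ (hδ j)] at h1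
  rw [div_le_iff₀ (hδ j)] at h2
  exact ⟨h1, by simp only [gridFloor]; linarith⟩

theorem card_gridPoints_le {δ : Fin N → ℝ} (hδ : ∀ j, 0 < δ j) (hδ1 : ∀ j, δ j ≤ 1) :
    ((gridPoints δ).card : ℝ) ≤ 2 ^ N * ∏ j, (δ j)⁻¹ := by
  have h1 : (gridPoints δ).card ≤ ∏ j, (⌊1 / δ j⌋₊ + 1) := by
    refine Finset.card_image_le.trans ?_
    simp
  calc ((gridPoints δ).card : ℝ) ≤ ∏ j, ((⌊1 / δ j⌋₊ : ℝ) + 1) := by exact_mod_cast h1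
    _ ≤ ∏ j, 2 * (δ j)⁻¹ := by
      refine Finset.prod_le_prod (fun j _ => by positivity) fun j _ => ?_
      have h2 := Nat.floor_le (one_div_nonneg.2 (hδ j).le)
      have h3 : 1 ≤ (δ j)⁻¹ := (one_le_inv₀ (hδ j)).2 (hδ1 j)
      rw [one_div] at h2 ⊢
      linarith
    _ = 2 ^ N * ∏ j, (δ j)⁻¹ := by simp [Finset.prod_mul_distrib]

/-- The anisotropic step sizes at level `n`. -/
noncomputable def levelStep (H : Fin N → ℝ) (n : ℕ) (j : Fin N) : ℝ :=
  ((1 / 2 : ℝ) ^ n) ^ (1 / H j)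

theorem levelStep_pos (H : Fin N → ℝ) (n : ℕ) (j : Fin N) : 0 < levelStep H n j := by
  unfold levelStep; positivity

theorem levelStep_le_pow (hH : ∀ j, 0 < H j) (hH1 : ∀ j, H j ≤ 1) (n : ℕ) (j : Fin N) :
    levelStep H n j ≤ (1 / 2 : ℝ) ^ n := by
  have := Real.rpow_le_rpow_of_exponent_ge (x := (1 / 2 : ℝ) ^ n) (by positivity)
    (pow_le_one₀ (by norm_num) (by norm_num)) ((one_le_div (hH j)).2 (hH1 j))
  rwa [Real.rpow_one] at this

theorem levelStep_succ_le (hH : ∀ j, 0 < H j) (n : ℕ) (j : Fin N) :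
    levelStep H (n + 1) j ≤ levelStep H n j := by
  refine Real.rpow_le_rpow (by positivity) ?_ (one_div_pos.2 (hH j)).le
  exact pow_le_pow_of_le_one (by norm_num) (by norm_num) n.le_succ

/-- **Chaining**: control of the increments over neighbouring grid points of all levels gives a
modulus of continuity. -/
theorem modulus_of_grid_increments {E : Type*} [PseudoMetricSpace E] {g : (Fin N → ℝ) → E}
    (hg : Continuous g) (hH : ∀ j, 0 < H j) (hH1 : ∀ j, H j ≤ 1) {h : ℝ} (hh : 0 < h) {n₀ : ℕ}
    (hinc : ∀ n ≥ n₀, ∀ u ∈ gridPoints (levelStep H n),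
      ∀ v ∈ gridPoints (levelStep H n) ∪ gridPoints (levelStep H (n + 1)),
      (∀ j, |u j - v j| ≤ 3 * levelStep H n j) → dist (g u) (g v) ≤ ((1 / 2 : ℝ) ^ n) ^ h)
    (n : ℕ) (hn : n₀ ≤ n) (s : Fin N → ℝ) (hs : s ∈ Icc (0 : Fin N → ℝ) 1) (t : Fin N → ℝ)
    (ht : t ∈ Icc (0 : Fin N → ℝ) 1) (hst : ∀ j, |s j - t j| ≤ levelStep H n j) :
    dist (g s) (g t) ≤ (1 + 2 / (1 - (1 / 2 : ℝ) ^ h)) * ((1 / 2 : ℝ) ^ n) ^ h := by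
  set q : ℝ := (1 / 2 : ℝ) ^ h with hq
  have hq1 : q < 1 := Real.rpow_lt_one (by norm_num) (by norm_num) hh
  have hpow : ∀ k : ℕ, ((1 / 2 : ℝ) ^ (n + k)) ^ h = ((1 / 2 : ℝ) ^ n) ^ h * q ^ k := fun k => by
    rw [pow_add, Real.mul_rpow (by positivity) (by positivity), hq, ← Real.rpow_natCast _ k,
      ← Real.rpow_natCast _ k, ← Real.rpow_mul (by norm_num), ← Real.rpow_mul (by norm_num),
      mul_comm (k : ℝ)]
  -- The grid floors of `t` converge to `t`, and consecutive ones have increments decaying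
  -- geometrically with ratio `q`.
  have hchain : ∀ t ∈ Icc (0 : Fin N → ℝ) 1,
      dist (g (gridFloor (levelStep H n) t)) (g t) ≤ ((1 / 2 : ℝ) ^ n) ^ h / (1 - q) := by
    intro t ht
    have hlim : Tendsto (fun k => gridFloor (levelStep H (n + k)) t) atTop (𝓝 t) := by
      rw [tendsto_pi_nhds]
      intro j
      have h0 : Tendsto (fun k : ℕ => (1 / 2 : ℝ) ^ (n + k)) atTop (𝓝 0) := by
        have := (tendsto_pow_atTop_nhds_zero_of_lt_one (r := (1 / 2 : ℝ)) (by norm_num)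
          (by norm_num)).comp (tendsto_add_atTop_nat n)
        refine this.congr fun k => by simp [add_comm]
      have h1 : Tendsto (fun k : ℕ => t j - (1 / 2 : ℝ) ^ (n + k)) atTop (𝓝 (t j)) := by
        simpa using h0.const_sub (t j)
      refine tendsto_of_tendsto_of_tendsto_of_le_of_le h1 tendsto_const_nhds (fun k => ?_)
        fun k => (gridFloor_bounds (levelStep_pos H _) ht j).1
      have h2 := (gridFloor_bounds (levelStep_pos H (n + k)) ht j).2
      have h3 := levelStep_le_pow hH hH1 (n + k) j
      simp only
      linarith
    have hstep : ∀ k, dist (g (gridFloor (levelStep H (n + k)) t))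
        (g (gridFloor (levelStep H (n + (k + 1))) t)) ≤ ((1 / 2 : ℝ) ^ n) ^ h * q ^ k := by
      intro k
      rw [← hpow]
      refine hinc (n + k) (by omega) _ (gridFloor_mem_gridPoints (levelStep_pos H _) ht) _
        (Finset.mem_union_right _ (gridFloor_mem_gridPoints (levelStep_pos H _) ht)) fun j => ?_
      have h1 := gridFloor_bounds (levelStep_pos H (n + k)) ht j
      have h2 := gridFloor_bounds (levelStep_pos H (n + k + 1)) ht j
      have h3 := levelStep_succ_le hH (n + k) j
      have h4 := levelStep_pos H (n + k) j
      rw [abs_le, ← add_assoc]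
      constructor <;> linarith [h1.1, h1.2, h2.1, h2.2]
    have := dist_le_of_le_geometric_of_tendsto q _ hq1 hstep ((hg.tendsto t).comp hlim) 0
    simpa using this
  -- Floors of points within one step of each other differ by at most two steps, inside the three
  -- allowed by `hinc`.
  have hmid : dist (g (gridFloor (levelStep H n) s)) (g (gridFloor (levelStep H n) t)) ≤
      ((1 / 2 : ℝ) ^ n) ^ h := by
    refine hinc n hn _ (gridFloor_mem_gridPoints (levelStep_pos H _) hs) _
        (Finset.mem_union_left _ (gridFloor_mem_gridPoints (levelStep_pos H _) ht)) fun j => ?_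
    have h1 := gridFloor_bounds (levelStep_pos H n) ht j
    have h2 := gridFloor_bounds (levelStep_pos H n) hs j
    have h3 := abs_le.1 (hst j)
    rw [abs_le]
    constructor <;> linarith [h1.1, h1.2, h2.1, h2.2, h3.1, h3.2]
  calc dist (g s) (g t) ≤ dist (g s) (g (gridFloor (levelStep H n) s)) +
        dist (g (gridFloor (levelStep H n) s)) (g (gridFloor (levelStep H n) t)) +
        dist (g (gridFloor (levelStep H n) t)) (g t) := dist_triangle4 _ _ _ _
    _ ≤ ((1 / 2 : ℝ) ^ n) ^ h / (1 - q) + ((1 / 2 : ℝ) ^ n) ^ h +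
        ((1 / 2 : ℝ) ^ n) ^ h / (1 - q) := by
        have := hchain s hs
        rw [dist_comm] at this
        exact add_le_add (add_le_add this hmid) (hchain t ht)
    _ = _ := by ring

/-- Polynomial tail bound for a vector with centered Gaussian components. -/
theorem measure_le_dist_le {s t : Fin N → ℝ} (hY : IsRegularGaussianField Y P H) {v : ℝ≥0}
    (hlaw : ∀ i, P.map (fun ω => Y t ω i - Y s ω i) = gaussianReal 0 v) {ε : ℝ} (hε : 0 < ε)
    (m : ℕ) :
    P {ω | ε ≤ dist (Y s ω) (Y t ω)} ≤
      p * (ENNReal.ofReal ((√(v : ℝ) / ε) ^ m) * ∫⁻ x, ‖x‖ₑ ^ m ∂(gaussianReal 0 1)) := by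
  have hsub : {ω | ε ≤ dist (Y s ω) (Y t ω)} ⊆
      ⋃ i, {ω | ENNReal.ofReal ε ^ m ≤ ‖Y t ω i - Y s ω i‖ₑ ^ m} := by
    intro ω hω
    by_contra hcon
    simp only [mem_iUnion, mem_ofPred_eq, not_exists] at hcon
    refine absurd ((dist_pi_lt_iff hε).2 fun i => ?_) (not_lt.2 hω)
    by_contra! hi
    refine hcon i (pow_le_pow_left' ?_ m)
    rw [← edist_eq_enorm_sub, edist_dist, dist_comm]
    exact ENNReal.ofReal_le_ofReal hi
  refine (measure_mono hsub).trans ((measure_iUnion_fintype_le _ _).trans ?_)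
  have hbound : ∀ i, P {ω | ENNReal.ofReal ε ^ m ≤ ‖Y t ω i - Y s ω i‖ₑ ^ m} ≤
      ENNReal.ofReal ((√(v : ℝ) / ε) ^ m) * ∫⁻ x, ‖x‖ₑ ^ m ∂(gaussianReal 0 1) := fun i => by
    have hm := hY.measurable_sub s t i
    refine (meas_ge_le_lintegral_div (hm.enorm.pow_const m).aemeasurable (by simp [hε])
      (by finiteness)).trans ?_
    have h1 : ∫⁻ ω, ‖Y t ω i - Y s ω i‖ₑ ^ m ∂P =
        ENNReal.ofReal √(v : ℝ) ^ m * ∫⁻ x, ‖x‖ₑ ^ m ∂(gaussianReal 0 1) := by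
      rw [← lintegral_enorm_pow_gaussianReal, ← hlaw i, lintegral_map (by fun_prop) hm]
    rw [h1, div_pow, ENNReal.ofReal_div_of_pos (by positivity), ENNReal.ofReal_pow hε.le,
      ENNReal.ofReal_pow (Real.sqrt_nonneg _), div_eq_mul_inv, div_eq_mul_inv]
    exact le_of_eq (by ring)
  calc ∑ i, P {ω | ENNReal.ofReal ε ^ m ≤ ‖Y t ω i - Y s ω i‖ₑ ^ m}
      ≤ ∑ _i : Fin p, ENNReal.ofReal ((√(v : ℝ) / ε) ^ m) *
          ∫⁻ x, ‖x‖ₑ ^ m ∂(gaussianReal 0 1) := Finset.sum_le_sum fun i _ => hbound i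
    _ = _ := by simp

/-- The steps are calibrated so that `levelStep H n j ^ (2 * H j)` is the square of `2 ^ (-n)` for
every `j`; the factor 9 bounds `3 ^ (2 * H j)`. -/
theorem variogram_le_of_levelStep (hH : ∀ j, 0 < H j) (hH1 : ∀ j, H j ≤ 1) {n : ℕ}
    {s t : Fin N → ℝ} (hst : ∀ j, |s j - t j| ≤ 3 * levelStep H n j) :
    ∑ j, |s j - t j| ^ (2 * H j) ≤ 9 * N * ((1 / 2 : ℝ) ^ n) ^ 2 := by
  have h1 : ∀ j ∈ Finset.univ, |s j - t j| ^ (2 * H j) ≤ 9 * ((1 / 2 : ℝ) ^ n) ^ 2 := fun j _ => by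
    have h2H : 0 ≤ 2 * H j := by have := hH j; positivity
    calc |s j - t j| ^ (2 * H j) ≤ (3 * levelStep H n j) ^ (2 * H j) :=
          Real.rpow_le_rpow (abs_nonneg _) (hst j) h2H
      _ = 3 ^ (2 * H j) * ((1 / 2 : ℝ) ^ n) ^ 2 := by
          rw [Real.mul_rpow (by norm_num) (levelStep_pos H n j).le, levelStep,
            ← Real.rpow_mul (by positivity), show 1 / H j * (2 * H j) = (2 : ℕ) by
              have := (hH j).ne'; field_simp; norm_num, Real.rpow_natCast]
      _ ≤ 9 * ((1 / 2 : ℝ) ^ n) ^ 2 := by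
          refine mul_le_mul_of_nonneg_right ?_ (by positivity)
          calc (3 : ℝ) ^ (2 * H j) ≤ 3 ^ (2 : ℝ) :=
                Real.rpow_le_rpow_of_exponent_le (by norm_num) (by linarith [hH1 j])
            _ = 9 := by norm_num
  refine (Finset.sum_le_card_nsmul _ _ _ h1).trans (le_of_eq ?_)
  simp; ring

theorem card_gridPoints_levelStep_le (hH : ∀ j, 0 < H j) (hH1 : ∀ j, H j ≤ 1) (n : ℕ) :
    ((gridPoints (levelStep H n)).card : ℝ) ≤
      2 ^ N * ((1 / 2 : ℝ) ^ n) ^ (-∑ j, 1 / H j) := by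
  refine (card_gridPoints_le (levelStep_pos H n) fun j =>
    (levelStep_le_pow hH hH1 n j).trans (pow_le_one₀ (by norm_num) (by norm_num))).trans
    (le_of_eq ?_)
  rw [← Finset.sum_neg_distrib, Real.rpow_sum_of_pos (by positivity)]
  congr 1
  refine Finset.prod_congr rfl fun j _ => ?_
  rw [levelStep, Real.rpow_neg (by positivity)]

/-- Almost sure anisotropic modulus of continuity, for every exponent `h < 1`. -/
theorem IsRegularGaussianField.ae_modulus (hY : IsRegularGaussianField Y P H)
    (hH : ∀ j, 0 < H j) (hH1 : ∀ j, H j ≤ 1) {h : ℝ} (hh : 0 < h) (hh1 : h < 1) :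
    ∀ᵐ ω ∂P, ∃ n₀ : ℕ, ∃ C : ℝ, ∀ n ≥ n₀, ∀ s ∈ Icc (0 : Fin N → ℝ) 1,
      ∀ t ∈ Icc (0 : Fin N → ℝ) 1, (∀ j, |s j - t j| ≤ ((1 / 2 : ℝ) ^ n) ^ (1 / H j)) →
        dist (Y s ω) (Y t ω) ≤ C * ((1 / 2 : ℝ) ^ n) ^ h := by
  classical
  obtain ⟨δ, hδ, c, hc, hinc⟩ := hY.increments
  set S := ∑ j, 1 / H j with hS
  have hS0 : 0 ≤ S := Finset.sum_nonneg fun j _ => (one_div_pos.2 (hH j)).le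
  -- With `r = 2 ^ (-n)`, about `r ^ (-2S)` grid pairs each fail with probability of order `r ^ (m
  -- (1 - h))`; this moment order makes the total at most of order `r`, which is summable.
  obtain ⟨m, hm⟩ : ∃ m : ℕ, 2 * S + 1 ≤ m * (1 - h) := by
    obtain ⟨m, hm⟩ := exists_nat_ge ((2 * S + 1) / (1 - h))
    exact ⟨m, by rwa [div_le_iff₀ (by linarith)] at hm⟩
  obtain ⟨n₁, hn₁⟩ : ∃ n₁ : ℕ, ∀ n ≥ n₁, 3 * (1 / 2 : ℝ) ^ n ≤ δ := by
    have h0 : Tendsto (fun n : ℕ => 3 * (1 / 2 : ℝ) ^ n) atTop (𝓝 (3 * 0)) :=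
      (tendsto_pow_atTop_nhds_zero_of_lt_one (by norm_num) (by norm_num)).const_mul 3
    rw [mul_zero] at h0
    obtain ⟨n₁, hn₁⟩ := eventually_atTop.1 (h0.eventually (Iio_mem_nhds hδ))
    exact ⟨n₁, fun n hn => le_of_lt (hn₁ n hn)⟩
  set K : ℝ := √(c * (9 * N)) with hK
  set M := ∫⁻ x, ‖x‖ₑ ^ m ∂(gaussianReal 0 1) with hM
  have hMt : M ≠ ∞ := (lintegral_enorm_pow_gaussianReal_one_lt_top m).ne
  let pairs : ℕ → Finset ((Fin N → ℝ) × (Fin N → ℝ)) := fun n =>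
    ((gridPoints (levelStep H n)) ×ˢ
      (gridPoints (levelStep H n) ∪ gridPoints (levelStep H (n + 1)))).filter
      fun z => ∀ j, |z.1 j - z.2 j| ≤ 3 * levelStep H n j
  let A : ℕ → Set Ω := fun n => ⋃ z ∈ pairs n,
    {ω | ((1 / 2 : ℝ) ^ n) ^ h ≤ dist (Y z.1 ω) (Y z.2 ω)}
  have hcard : ∀ n, ((pairs n).card : ℝ) ≤
      2 ^ N * (2 ^ N * (1 + 2 ^ S)) * ((1 / 2 : ℝ) ^ n) ^ (-(2 * S)) := fun n => by
    have hr : 0 < (1 / 2 : ℝ) ^ n := by positivity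
    have h1 := card_gridPoints_levelStep_le hH hH1 n
    have h2 := card_gridPoints_levelStep_le hH hH1 (n + 1)
    have h3 : ((1 / 2 : ℝ) ^ (n + 1)) ^ (-S) = 2 ^ S * ((1 / 2 : ℝ) ^ n) ^ (-S) := by
      rw [pow_succ, Real.mul_rpow hr.le (by norm_num), mul_comm, Real.rpow_neg (by norm_num),
        one_div, Real.inv_rpow zero_le_two, inv_inv]
    rw [h3] at h2
    have h4 : (pairs n).card ≤ (gridPoints (levelStep H n)).card *
        ((gridPoints (levelStep H n)).card + (gridPoints (levelStep H (n + 1))).card) := by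
      refine (Finset.card_filter_le _ _).trans ?_
      rw [Finset.card_product]
      exact Nat.mul_le_mul_left _ (Finset.card_union_le _ _)
    calc ((pairs n).card : ℝ) ≤ (gridPoints (levelStep H n)).card *
        ((gridPoints (levelStep H n)).card + (gridPoints (levelStep H (n + 1))).card) := by
          exact_mod_cast h4
      _ ≤ (2 ^ N * ((1 / 2 : ℝ) ^ n) ^ (-S)) * (2 ^ N * ((1 / 2 : ℝ) ^ n) ^ (-S) +
          2 ^ N * (2 ^ S * ((1 / 2 : ℝ) ^ n) ^ (-S))) := by gcongr
      _ = 2 ^ N * (2 ^ N * (1 + 2 ^ S)) * (((1 / 2 : ℝ) ^ n) ^ (-S) * ((1 / 2 : ℝ) ^ n) ^ (-S)) := by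
          ring
      _ = _ := by rw [← Real.rpow_add hr]; congr 2; ring
  set B : ℝ := 2 ^ N * (2 ^ N * (1 + 2 ^ S)) * K ^ m with hB
  have hAn : ∀ n ≥ n₁, P (A n) ≤ p * M * ENNReal.ofReal (B * (1 / 2 : ℝ) ^ n) := by
    intro n hn
    have hr : 0 < (1 / 2 : ℝ) ^ n := by positivity
    have hr1 : (1 / 2 : ℝ) ^ n ≤ 1 := pow_le_one₀ (by norm_num) (by norm_num)
    have hz : ∀ z ∈ pairs n, P {ω | ((1 / 2 : ℝ) ^ n) ^ h ≤ dist (Y z.1 ω) (Y z.2 ω)} ≤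
        p * M * ENNReal.ofReal (K ^ m * ((1 / 2 : ℝ) ^ n) ^ (m * (1 - h))) := by
      intro z hz
      obtain ⟨hz1, hz2⟩ := Finset.mem_filter.1 hz
      obtain ⟨hz3, hz4⟩ := Finset.mem_product.1 hz1
      have hm1 := mem_Icc_of_mem_gridPoints (levelStep_pos H n) hz3
      have hm2 : z.2 ∈ Icc (0 : Fin N → ℝ) 1 := by
        rcases Finset.mem_union.1 hz4 with h | h
        · exact mem_Icc_of_mem_gridPoints (levelStep_pos H _) h
        · exact mem_Icc_of_mem_gridPoints (levelStep_pos H _) h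
      obtain ⟨v, -, hv, hlaw, -⟩ := hinc z.1 hm1 z.2 hm2 fun j =>
        (hz2 j).trans ((mul_le_mul_of_nonneg_left (levelStep_le_pow hH hH1 n j)
          zero_le_three).trans (hn₁ n hn))
      have hsv : √(v : ℝ) ≤ K * (1 / 2 : ℝ) ^ n := by
        rw [hK, ← Real.sqrt_sq hr.le, ← Real.sqrt_mul (by positivity)]
        refine Real.sqrt_le_sqrt (hv.trans ?_)
        have := variogram_le_of_levelStep hH hH1 hz2
        rw [mul_assoc]
        exact mul_le_mul_of_nonneg_left this (by linarith)
      refine (measure_le_dist_le hY hlaw (Real.rpow_pos_of_pos hr h) m).trans ?_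
      rw [mul_comm (ENNReal.ofReal _), ← mul_assoc]
      refine mul_le_mul' le_rfl (ENNReal.ofReal_le_ofReal ?_)
      calc (√(v : ℝ) / ((1 / 2 : ℝ) ^ n) ^ h) ^ m
          ≤ (K * (1 / 2 : ℝ) ^ n / ((1 / 2 : ℝ) ^ n) ^ h) ^ m := by gcongr
        _ = K ^ m * (((1 / 2 : ℝ) ^ n) ^ (1 - h)) ^ m := by
            rw [mul_div_assoc, mul_pow, Real.rpow_sub hr, Real.rpow_one]
        _ = K ^ m * ((1 / 2 : ℝ) ^ n) ^ (m * (1 - h)) := by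
            rw [mul_comm (m : ℝ), Real.rpow_mul hr.le, Real.rpow_natCast]
    calc P (A n) ≤ ∑ z ∈ pairs n, P {ω | ((1 / 2 : ℝ) ^ n) ^ h ≤ dist (Y z.1 ω) (Y z.2 ω)} :=
          measure_biUnion_finset_le _ _
      _ ≤ (pairs n).card •
          (p * M * ENNReal.ofReal (K ^ m * ((1 / 2 : ℝ) ^ n) ^ (m * (1 - h)))) :=
          Finset.sum_le_card_nsmul _ _ _ hz
      _ = p * M * ENNReal.ofReal ((pairs n).card * (K ^ m * ((1 / 2 : ℝ) ^ n) ^ (m * (1 - h)))) := by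
          rw [nsmul_eq_mul, ENNReal.ofReal_mul (Nat.cast_nonneg _), ENNReal.ofReal_natCast]
          ring
      _ ≤ p * M * ENNReal.ofReal (B * (1 / 2 : ℝ) ^ n) := by
          refine mul_le_mul' le_rfl (ENNReal.ofReal_le_ofReal ?_)
          have hK0 : 0 ≤ K := Real.sqrt_nonneg _
          calc (pairs n).card * (K ^ m * ((1 / 2 : ℝ) ^ n) ^ (m * (1 - h)))
              ≤ (2 ^ N * (2 ^ N * (1 + 2 ^ S)) * ((1 / 2 : ℝ) ^ n) ^ (-(2 * S))) *
                (K ^ m * ((1 / 2 : ℝ) ^ n) ^ (m * (1 - h))) :=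
                mul_le_mul_of_nonneg_right (hcard n) (by positivity)
            _ = B * ((1 / 2 : ℝ) ^ n) ^ (-(2 * S) + m * (1 - h)) := by
                rw [Real.rpow_add hr, hB]; ring
            _ ≤ B * (1 / 2 : ℝ) ^ n := by
                refine mul_le_mul_of_nonneg_left ?_ (by positivity)
                have := Real.rpow_le_rpow_of_exponent_ge hr hr1
                  (show (1 : ℝ) ≤ -(2 * S) + m * (1 - h) by linarith)
                rwa [Real.rpow_one] at this
  have hsum : ∑' k, P (A (k + n₁)) ≠ ∞ := by
    have hB0 : 0 ≤ B := by have : 0 ≤ K := Real.sqrt_nonneg _; positivity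
    have hs : Summable fun k : ℕ => B * (1 / 2 : ℝ) ^ (k + n₁) :=
      ((summable_nat_add_iff n₁).2 (summable_geometric_of_lt_one (by norm_num)
        (by norm_num))).mul_left B
    refine ne_top_of_le_ne_top ?_ (ENNReal.tsum_le_tsum fun k => hAn (k + n₁) (by omega))
    rw [ENNReal.tsum_mul_left, ← ENNReal.ofReal_tsum_of_nonneg (fun k => by positivity) hs]
    finiteness
  -- Borel–Cantelli: almost surely only finitely many levels contain a bad pair.
  filter_upwards [ae_eventually_notMem hsum] with ω hω
  obtain ⟨k₀, hk₀⟩ := eventually_atTop.1 hω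
  refine ⟨k₀ + n₁, _, modulus_of_grid_increments (hY.continuous ω) hH hH1 hh
    (n₀ := k₀ + n₁) fun n hn u hu v hv huv => ?_⟩
  have h1 : ω ∉ A n := by
    have := hk₀ (n - n₁) (by omega)
    rwa [Nat.sub_add_cancel (by omega)] at this
  by_contra! hcon
  refine h1 (mem_biUnion (x := (u, v)) ?_ hcon.le)
  exact Finset.mem_filter.2 ⟨Finset.mem_product.2 ⟨hu, hv⟩, huv⟩

end Chaining

/-! ### Exact dimensions for regular fields. -/

section Dimension

variable {N p : ℕ} {Ω : Type*} [MeasurableSpace Ω] {P : Measure Ω}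
  {Y : (Fin N → ℝ) → Ω → Fin p → ℝ} {H : Fin N → ℝ}

theorem ae_ofReal_le_of_forall_lt {D : ℝ} {d : Ω → ℝ≥0∞}
    (h : ∀ x < D, ∀ᵐ ω ∂P, ENNReal.ofReal x ≤ d ω) : ∀ᵐ ω ∂P, ENNReal.ofReal D ≤ d ω := by
  have h1 : ∀ᵐ ω ∂P, ∀ m : ℕ, ENNReal.ofReal (D - 1 / ((m : ℝ) + 1)) ≤ d ω :=
    ae_all_iff.2 fun m => h _ (sub_lt_self _ (by positivity))
  filter_upwards [h1] with ω hω
  have h2 : Tendsto (fun m : ℕ => D - 1 / ((m : ℝ) + 1)) atTop (𝓝 D) := by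
    simpa using (tendsto_one_div_add_atTop_nhds_zero_nat (𝕜 := ℝ)).const_sub D
  exact le_of_tendsto' (ENNReal.tendsto_ofReal h2) hω

theorem dimH_image_le_dimH_graph {T X : Type*} [EMetricSpace T] [EMetricSpace X] (g : T → X)
    (A : Set T) : dimH (g '' A) ≤ dimH ((fun t => (t, g t)) '' A) := by
  have := (LipschitzWith.prod_snd (α := T) (β := X)).dimH_image_le ((fun t => (t, g t)) '' A)
  rwa [image_image] at this

/-- Monotonicity of `H` decides each maximum: `1 / H j` up to `k`, `1 / H k` beyond. This identifies
the covering exponent at `θ = 1 / H k` with the `k`-th term of the formula. -/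
theorem mul_sum_max_one_div (hH : ∀ j, 0 < H j) (hmono : Monotone H) (k : Fin N) :
    H k * ∑ j, max (1 / H j) (1 / H k) =
      (∑ j ∈ Finset.Iic k, H k / H j) + ((N : ℝ) - ((k : ℝ) + 1)) := by
  classical
  rw [Finset.mul_sum, ← Finset.sum_add_sum_compl (Finset.Iic k)]
  congr 1
  · refine Finset.sum_congr rfl fun j hj => ?_
    rw [max_eq_left (one_div_le_one_div_of_le (hH j) (hmono (Finset.mem_Iic.1 hj)))]
    ring
  · have h1 : ∀ j ∈ (Finset.Iic k)ᶜ, H k * max (1 / H j) (1 / H k) = 1 := fun j hj => by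
      have hkj : k < j := by simpa using hj
      rw [max_eq_right (one_div_le_one_div_of_le (hH k) (hmono hkj.le)),
        mul_one_div_cancel (hH k).ne']
    rw [Finset.sum_congr rfl h1, Finset.sum_const, Finset.card_compl, Fintype.card_fin,
      Fin.card_Iic, nsmul_eq_mul, mul_one, Nat.cast_sub (by omega)]
    push_cast; ring

/-- Almost sure upper bound for the dimension of the graph. -/
theorem IsRegularGaussianField.ae_dimH_graph_le (hY : IsRegularGaussianField Y P H)
    (hN : 1 ≤ N) (hH : ∀ j, 0 < H j) (hmono : Monotone H) (hH1 : ∀ j, H j ≤ 1) :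
    ∀ᵐ ω ∂P, dimH ((fun t => (t, Y t ω)) '' Icc (0 : Fin N → ℝ) 1) ≤
      ENNReal.ofReal (min (⨅ k : Fin N, (∑ j ∈ Finset.Iic k, H k / H j) +
        ((N : ℝ) - ((k : ℝ) + 1)) + (1 - H k) * (p : ℝ)) (∑ j, 1 / H j)) := by
  -- A sequence in `(0, 1)` tending to 1, so one null set serves all exponents; the shift by 2 keeps
  -- `h 0` positive.
  let h : ℕ → ℝ := fun m => 1 - 1 / ((m : ℝ) + 2)
  have hpos : ∀ m, 0 < h m := fun m => by
    have : 1 / ((m : ℝ) + 2) < 1 := by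
      rw [div_lt_one (by positivity)]; linarith [(Nat.cast_nonneg m : (0 : ℝ) ≤ m)]
    simp only [h]; linarith
  have hlt : ∀ m, h m < 1 := fun m => sub_lt_self _ (by positivity)
  have hlim : Tendsto h atTop (𝓝 1) := by
    have h1 : Tendsto (fun m : ℕ => 1 / ((m : ℝ) + 2)) atTop (𝓝 0) := by
      have := (tendsto_one_div_add_atTop_nhds_zero_nat (𝕜 := ℝ)).comp (tendsto_add_atTop_nat 1)
      refine this.congr fun m => ?_
      simp only [Function.comp]; push_cast; ring
    simpa [h] using h1.const_sub 1
  filter_upwards [ae_all_iff.2 fun m => hY.ae_modulus hH hH1 (hpos m) (hlt m)] with ω hω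
  have hone : ∀ j, 1 ≤ 1 / H j := fun j => (one_le_div (hH j)).2 (hH1 j)
  have hbound : ∀ m θ, h m ≤ θ → dimH ((fun t => (t, Y t ω)) '' Icc (0 : Fin N → ℝ) 1) ≤
      ENNReal.ofReal ((∑ j, max (1 / H j) θ + p * (θ - h m)) / θ) := fun m θ hθ => by
    obtain ⟨n₀, C, hC⟩ := hω m
    exact dimH_graph_le_of_modulus (hpos m) hθ n₀ hC
  have hne : Nonempty (Fin N) := ⟨⟨0, hN⟩⟩
  rw [ENNReal.ofReal_min]
  refine le_min ?_ ?_
  · obtain ⟨k, hk⟩ := exists_eq_ciInf_of_finite (f := fun k : Fin N =>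
      (∑ j ∈ Finset.Iic k, H k / H j) + ((N : ℝ) - ((k : ℝ) + 1)) + (1 - H k) * (p : ℝ))
    rw [← hk, ← mul_sum_max_one_div hH hmono k]
    have hl : Tendsto (fun m => H k * ∑ j, max (1 / H j) (1 / H k) + (1 - H k * h m) * p) atTop
        (𝓝 (H k * ∑ j, max (1 / H j) (1 / H k) + (1 - H k) * p)) := by
      have := (((hlim.const_mul (H k)).const_sub 1).mul_const (p : ℝ)).const_add
        (H k * ∑ j, max (1 / H j) (1 / H k))
      rwa [mul_one] at this
    refine ge_of_tendsto' (ENNReal.tendsto_ofReal hl) fun m => ?_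
    refine (hbound m (1 / H k) ((hlt m).le.trans (hone k))).trans (le_of_eq ?_)
    congr 1
    have := (hH k).ne'
    field_simp
  -- With `θ = h m` the range term vanishes, and every maximum is `1 / H j` because `h m < 1 ≤ 1 / H
  -- j`.
  · have hl : Tendsto (fun m => (∑ j, 1 / H j) / h m) atTop (𝓝 (∑ j, 1 / H j)) := by
      have := (tendsto_const_nhds (x := ∑ j, 1 / H j)).div hlim one_ne_zero
      rwa [div_one] at this
    refine ge_of_tendsto' (ENNReal.tendsto_ofReal hl) fun m => ?_
    refine (hbound m (h m) le_rfl).trans (le_of_eq ?_)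
    rw [sub_self, mul_zero, add_zero]
    simp_rw [max_eq_left ((hlt m).le.trans (hone _))]

/-- Almost sure dimension of the image. -/
theorem IsRegularGaussianField.ae_dimH_image_eq [IsProbabilityMeasure P]
    (hY : IsRegularGaussianField Y P H) (hN : 1 ≤ N) (hp : 1 ≤ p) (hH : ∀ j, 0 < H j)
    (hmono : Monotone H) (hH1 : ∀ j, H j ≤ 1) :
    ∀ᵐ ω ∂P, dimH ((fun t => Y t ω) '' Icc (0 : Fin N → ℝ) 1) =
      ENNReal.ofReal (min (p : ℝ) (∑ j, 1 / H j)) := by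
  have hne : (Finset.univ : Finset (Fin N)).Nonempty := ⟨⟨0, hN⟩, Finset.mem_univ _⟩
  have hS0 : 0 < ∑ j, 1 / H j := Finset.sum_pos (fun j _ => one_div_pos.2 (hH j)) hne
  have hp0 : (0 : ℝ) < p := by exact_mod_cast hp
  have hlow : ∀ᵐ ω ∂P, ENNReal.ofReal (min (p : ℝ) (∑ j, 1 / H j)) ≤
      dimH ((fun t => Y t ω) '' Icc (0 : Fin N → ℝ) 1) := by
    refine ae_ofReal_le_of_forall_lt fun x hx => ?_
    have hx' := lt_min_iff.1 hx
    -- `x` may be negative; `toNNReal` then gives 0, still below the positive bounds.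
    refine hY.ae_le_dimH_image hN hp hH (γ := x.toNNReal) ?_ ?_
    · rw [Real.coe_toNNReal']; exact max_lt hx'.1 hp0
    · rw [Real.coe_toNNReal']; exact max_lt hx'.2 hS0
  filter_upwards [hlow, hY.ae_dimH_graph_le hN hH hmono hH1] with ω h1 h2
  refine le_antisymm ?_ h1
  rw [ENNReal.ofReal_min]
  refine le_min ?_ ?_
  · rw [ENNReal.ofReal_natCast, ← Real.dimH_univ_pi_fin p]
    exact dimH_mono (subset_univ _)
  · exact (dimH_image_le_dimH_graph _ _).trans
      (h2.trans (ENNReal.ofReal_le_ofReal (min_le_right _ _)))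

/-- Almost sure dimension of the graph. -/
theorem IsRegularGaussianField.ae_dimH_graph_eq [IsProbabilityMeasure P]
    (hY : IsRegularGaussianField Y P H) (hN : 1 ≤ N) (hp : 1 ≤ p) (hH : ∀ j, 0 < H j)
    (hmono : Monotone H) (hH1 : ∀ j, H j ≤ 1) :
    ∀ᵐ ω ∂P, dimH ((fun t => (t, Y t ω)) '' Icc (0 : Fin N → ℝ) 1) =
      ENNReal.ofReal (min (⨅ k : Fin N, (∑ j ∈ Finset.Iic k, H k / H j) +
        ((N : ℝ) - ((k : ℝ) + 1)) + (1 - H k) * (p : ℝ)) (∑ j, 1 / H j)) := by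
  set D := min (⨅ k : Fin N, (∑ j ∈ Finset.Iic k, H k / H j) +
        ((N : ℝ) - ((k : ℝ) + 1)) + (1 - H k) * (p : ℝ)) (∑ j, 1 / H j) with hD
  have hlow : ∀ᵐ ω ∂P, ENNReal.ofReal D ≤
      dimH ((fun t => (t, Y t ω)) '' Icc (0 : Fin N → ℝ) 1) := by
    refine ae_ofReal_le_of_forall_lt fun x hx => ?_
    by_cases hxp : x < p
    · filter_upwards [hY.ae_dimH_image_eq hN hp hH hmono hH1] with ω hω
      refine le_trans ?_ (dimH_image_le_dimH_graph _ _)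
      rw [hω]
      exact ENNReal.ofReal_le_ofReal (le_min hxp.le (hx.le.trans (min_le_right _ _)))
    · have hp0 : (0 : ℝ) ≤ p := Nat.cast_nonneg p
      -- The graph energy bound requires an exponent strictly above `p`, while `x` may equal `p`.
      obtain ⟨y, hxy, hyD⟩ := exists_between hx
      have hpy : (p : ℝ) < y := (not_lt.1 hxp).trans_lt hxy
      have hy := lt_min_iff.1 hyD
      have hyc : ((y.toNNReal : ℝ≥0) : ℝ) = y := Real.coe_toNNReal _ (hp0.trans hpy.le)
      have := hY.ae_le_dimH_graph hN hp hH hH1 (γ := y.toNNReal) (by rwa [hyc])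
        (hpy.trans hy.2) fun k => by
          rw [hyc]
          exact hy.1.trans_le (ciInf_le (Set.finite_range _).bddBelow k)
      filter_upwards [this] with ω hω
      exact (ENNReal.ofReal_le_ofReal hxy.le).trans hω
  filter_upwards [hlow, hY.ae_dimH_graph_le hN hH hmono hH1] with ω h1 h2
  exact le_antisymm h2 h1

end Dimension

/-! ### From the given copies to a regular field, and from sup norm to Euclidean norm. -/

section Regularization

variable {N p : ℕ} {Ω Ω₀ : Type*} [MeasurableSpace Ω] [MeasurableSpace Ω₀] {P : Measure Ω}
  {P₀ : Measure Ω₀} {X : EuclideanSpace ℝ (Fin N) → Ω₀ → ℝ}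
  {Xs : Fin p → EuclideanSpace ℝ (Fin N) → Ω → ℝ} {H : Fin N → ℝ}

/-- Coordinatewise projection of `ℝ^N` onto the unit cube. -/
noncomputable def clampCube {N : ℕ} (t : Fin N → ℝ) : EuclideanSpace ℝ (Fin N) :=
  WithLp.toLp 2 fun j => max 0 (min 1 (t j))

theorem continuous_clampCube : Continuous (clampCube (N := N)) := by
  refine (PiLp.continuous_toLp 2 _).comp ?_
  fun_prop

theorem clampCube_mem (t : Fin N → ℝ) : clampCube t ∈ unitCube N := fun _ =>
  ⟨le_max_left _ _, max_le zero_le_one (min_le_left _ _)⟩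

theorem clampCube_of_mem {t : Fin N → ℝ} (ht : t ∈ Icc (0 : Fin N → ℝ) 1) :
    clampCube t = WithLp.toLp 2 t := by
  have : (fun j => max 0 (min 1 (t j))) = t := funext fun j => by
    have h1 : t j ≤ 1 := ht.2 j
    rw [min_eq_right h1]
    exact max_eq_right (ht.1 j)
  rw [clampCube, this]

theorem AreIndependentCopies.aemeasurable (hXs : AreIndependentCopies Xs P X P₀) (i : Fin p)
    (t : EuclideanSpace ℝ (Fin N)) : AEMeasurable (Xs i t) P :=
  (measurable_pi_apply (⟨t, by simp⟩ : ({t} : Finset (EuclideanSpace ℝ (Fin N))))).comp_aemeasurable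
    (hXs.identDistrib i {t}).aemeasurable_fst

/-- A field with almost surely continuous paths on the cube agrees there, almost surely, with a
field that is measurable and has all its paths continuous. -/
theorem exists_continuous_measurable_version
    (hXs : ∀ i t, AEMeasurable (Xs i t) P)
    (hcont : ∀ᵐ ω ∂P, ContinuousOn (sampleFunction Xs ω) (unitCube N)) :
    ∃ Y : (Fin N → ℝ) → Ω → Fin p → ℝ, (∀ ω, Continuous fun t => Y t ω) ∧
      (∀ t, Measurable (Y t)) ∧ ∀ᵐ ω ∂P, ∀ t ∈ Icc (0 : Fin N → ℝ) 1, ∀ i,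
        Y t ω i = Xs i (WithLp.toLp 2 t) ω := by
  classical
  set d := TopologicalSpace.denseSeq (Fin N → ℝ) with hd
  have hgood : ∀ᵐ ω ∂P, ContinuousOn (sampleFunction Xs ω) (unitCube N) ∧
      ∀ n i, Xs i (clampCube (d n)) ω = (hXs i (clampCube (d n))).mk _ ω :=
    hcont.and (ae_all_iff.2 fun n => ae_all_iff.2 fun i => (hXs i _).ae_eq_mk)
  -- Off the measurable null set `B` paths are continuous on the cube and agree with measurable
  -- modifications at the clamped points of a countable dense set. Setting the field to 0 on `B`
  -- makes it measurable at those points, and path continuity extends this to all `t`.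
  obtain ⟨B, hB, hBm, hB0⟩ := exists_measurable_superset_of_null (ae_iff.1 hgood)
  have hBc : ∀ ω, ω ∉ B → ContinuousOn (sampleFunction Xs ω) (unitCube N) ∧
      ∀ n i, Xs i (clampCube (d n)) ω = (hXs i (clampCube (d n))).mk _ ω := fun ω hω => by
    by_contra hcon
    exact hω (hB hcon)
  set Y : (Fin N → ℝ) → Ω → Fin p → ℝ := fun t ω =>
    if ω ∈ B then 0 else fun i => Xs i (clampCube t) ω with hY
  have hYc : ∀ ω, Continuous fun t => Y t ω := fun ω => by
    by_cases hω : ω ∈ B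
    · simpa only [hY, if_pos hω] using continuous_const
    · simp only [hY, if_neg hω]
      exact (PiLp.continuous_ofLp 2 _).comp
        ((hBc ω hω).1.comp_continuous continuous_clampCube clampCube_mem)
  have hYd : ∀ n, Measurable (Y (d n)) := fun n => by
    have : Y (d n) = fun ω => if ω ∈ B then 0 else
        fun i => (hXs i (clampCube (d n))).mk _ ω := by
      funext ω
      by_cases hω : ω ∈ B
      · simp only [hY, if_pos hω]
      · simp only [hY, if_neg hω, (hBc ω hω).2 n]
    rw [this]
    exact Measurable.ite hBm measurable_const
      (measurable_pi_lambda _ fun i => (hXs i _).measurable_mk)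
  refine ⟨Y, hYc, fun t => ?_, ?_⟩
  · obtain ⟨x, hx, hxt⟩ := mem_closure_iff_seq_limit.1
      (TopologicalSpace.denseRange_denseSeq (Fin N → ℝ) t)
    choose n hn using hx
    refine measurable_of_tendsto_metrizable (fun k => hYd (n k)) (tendsto_pi_nhds.2 fun ω => ?_)
    simp only [hd, hn]
    exact ((hYc ω).tendsto t).comp hxt
  · filter_upwards [measure_eq_zero_iff_ae_notMem.1 hB0] with ω hω t ht i
    simp only [hY, if_neg hω, clampCube_of_mem ht]

theorem map_increment_eq_gaussianReal (hX : IsCenteredGaussianField X P₀)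
    (s t : EuclideanSpace ℝ (Fin N)) : ∃ v : ℝ≥0, (v : ℝ) = ∫ ω, (X t ω - X s ω) ^ 2 ∂P₀ ∧
      P₀.map (fun ω => X t ω - X s ω) = gaussianReal 0 v := by
  have hG := hX.isGaussian.hasGaussianLaw_fun_sub (s := t) (t := s)
  have hmean : ∫ ω, (X t ω - X s ω) ∂P₀ = 0 := by
    rw [integral_sub (hX.isGaussian.hasGaussianLaw_eval t).integrable
      (hX.isGaussian.hasGaussianLaw_eval s).integrable, hX.centered, hX.centered, sub_zero]
  have hvar := variance_of_integral_eq_zero hG.aemeasurable hmean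
  refine ⟨Real.toNNReal Var[fun ω => X t ω - X s ω; P₀], ?_, ?_⟩
  · rw [Real.coe_toNNReal _ (variance_nonneg _ _), hvar]
  · rw [hG.map_eq_gaussianReal, hmean]

theorem map_copy_increment (hXs : AreIndependentCopies Xs P X P₀) (i : Fin p)
    (s t : EuclideanSpace ℝ (Fin N)) :
    P.map (fun ω => Xs i t ω - Xs i s ω) = P₀.map (fun ω => X t ω - X s ω) := by
  classical
  have hf : Measurable fun f : (({s, t} : Finset (EuclideanSpace ℝ (Fin N))) → ℝ) =>
      f ⟨t, by simp⟩ - f ⟨s, by simp⟩ :=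
    (measurable_pi_apply _).sub (measurable_pi_apply _)
  exact ((hXs.identDistrib i {s, t}).comp hf).map_eq

theorem iIndepFun_increments (hXs : AreIndependentCopies Xs P X P₀)
    (s t : EuclideanSpace ℝ (Fin N)) : iIndepFun (fun i ω => Xs i t ω - Xs i s ω) P :=
  hXs.indep.comp (fun _ f => f t - f s) fun _ =>
    (measurable_pi_apply t).sub (measurable_pi_apply s)

theorem exists_isRegularGaussianField (hX : IsCenteredGaussianField X P₀)
    (hD1 : ConditionD1 X P₀ H) (hXs : AreIndependentCopies Xs P X P₀)
    (hcont : ∀ᵐ ω ∂P, ContinuousOn (sampleFunction Xs ω) (unitCube N)) :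
    ∃ Y : (Fin N → ℝ) → Ω → Fin p → ℝ, IsRegularGaussianField Y P H ∧
      ∀ᵐ ω ∂P, ∀ t ∈ Icc (0 : Fin N → ℝ) 1, ∀ i, Y t ω i = Xs i (WithLp.toLp 2 t) ω := by
  obtain ⟨Y, hYc, hYm, hY⟩ := exists_continuous_measurable_version hXs.aemeasurable hcont
  refine ⟨Y, ⟨hYc, hYm, ?_⟩, hY⟩
  obtain ⟨δ₀, hδ₀, c, hc, hvar⟩ := hD1
  -- If all coordinates differ by at most `δ₀ / (N + 1)`, the squared Euclidean distance is at most
  -- `N / (N + 1) ^ 2 * δ₀ ^ 2 ≤ δ₀ ^ 2`; `N + 1` also avoids division by zero.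
  refine ⟨δ₀ / (N + 1), by positivity, c, hc, fun s hs t ht hst => ?_⟩
  obtain ⟨v, hv, hlaw⟩ := map_increment_eq_gaussianReal hX (WithLp.toLp 2 s) (WithLp.toLp 2 t)
  have hnorm : ‖(WithLp.toLp 2 s : EuclideanSpace ℝ (Fin N)) - WithLp.toLp 2 t‖ ≤ δ₀ := by
    rw [EuclideanSpace.norm_eq]
    refine Real.sqrt_le_iff.2 ⟨hδ₀.le, ?_⟩
    calc ∑ j, ‖((WithLp.toLp 2 s : EuclideanSpace ℝ (Fin N)) - WithLp.toLp 2 t) j‖ ^ 2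
        ≤ ∑ _j : Fin N, (δ₀ / (N + 1)) ^ 2 :=
          Finset.sum_le_sum fun j _ => pow_le_pow_left₀ (norm_nonneg _) (hst j) 2
      _ = (N / (N + 1) ^ 2) * δ₀ ^ 2 := by
          rw [Finset.sum_const, Finset.card_univ, Fintype.card_fin, nsmul_eq_mul, div_pow]
          ring
      _ ≤ 1 * δ₀ ^ 2 := by
          refine mul_le_mul_of_nonneg_right ?_ (by positivity)
          rw [div_le_one (by positivity)]
          nlinarith [(Nat.cast_nonneg N : (0 : ℝ) ≤ N)]
      _ = δ₀ ^ 2 := one_mul _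
  obtain ⟨h1, h2⟩ := hvar (WithLp.toLp 2 s) (fun j => ⟨hs.1 j, hs.2 j⟩) (WithLp.toLp 2 t)
    (fun j => ⟨ht.1 j, ht.2 j⟩) hnorm
  rw [← hv] at h1 h2
  have hae : ∀ i, (fun ω => Y t ω i - Y s ω i) =ᵐ[P]
      fun ω => Xs i (WithLp.toLp 2 t) ω - Xs i (WithLp.toLp 2 s) ω := fun i => by
    filter_upwards [hY] with ω hω
    rw [hω t ht, hω s hs]
  refine ⟨v, h1, h2, fun i => ?_, ?_⟩
  · rw [Measure.map_congr (hae i), map_copy_increment hXs, hlaw]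
  · exact (iIndepFun_congr hae).2 (iIndepFun_increments hXs _ _)

/-- Writing the Euclidean image through a continuous linear equivalence lets the dimension be
computed in sup-norm coordinates. -/
theorem image_unitCube_eq {g : EuclideanSpace ℝ (Fin N) → EuclideanSpace ℝ (Fin p)}
    {y : (Fin N → ℝ) → Fin p → ℝ}
    (h : ∀ t ∈ Icc (0 : Fin N → ℝ) 1, g (WithLp.toLp 2 t) = WithLp.toLp 2 (y t)) :
    g '' unitCube N = (EuclideanSpace.equiv (Fin p) ℝ).symm '' (y '' Icc (0 : Fin N → ℝ) 1) := by
  rw [image_image]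
  ext z
  constructor
  · rintro ⟨t, ht, rfl⟩
    exact ⟨WithLp.ofLp t, ⟨fun j => (ht j).1, fun j => (ht j).2⟩,
      (h _ ⟨fun j => (ht j).1, fun j => (ht j).2⟩).symm⟩
  · rintro ⟨t, ht, rfl⟩
    exact ⟨WithLp.toLp 2 t, fun j => ⟨ht.1 j, ht.2 j⟩, h t ht⟩

theorem graphOver_unitCube_eq {g : EuclideanSpace ℝ (Fin N) → EuclideanSpace ℝ (Fin p)}
    {y : (Fin N → ℝ) → Fin p → ℝ}
    (h : ∀ t ∈ Icc (0 : Fin N → ℝ) 1, g (WithLp.toLp 2 t) = WithLp.toLp 2 (y t)) :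
    graphOver g (unitCube N) =
      (((EuclideanSpace.equiv (Fin N) ℝ).symm.prodCongr
        (EuclideanSpace.equiv (Fin p) ℝ).symm).trans
        (WithLp.prodContinuousLinearEquiv 2 ℝ (EuclideanSpace ℝ (Fin N))
          (EuclideanSpace ℝ (Fin p))).symm) ''
        ((fun t => (t, y t)) '' Icc (0 : Fin N → ℝ) 1) := by
  rw [image_image, graphOver]
  ext z
  constructor
  · rintro ⟨t, ht, rfl⟩
    refine ⟨WithLp.ofLp t, ⟨fun j => (ht j).1, fun j => (ht j).2⟩, ?_⟩
    have := h (WithLp.ofLp t) ⟨fun j => (ht j).1, fun j => (ht j).2⟩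
    rw [WithLp.toLp_ofLp] at this
    simp only [this]
    rfl
  · rintro ⟨t, ht, rfl⟩
    refine ⟨WithLp.toLp 2 t, fun j => ⟨ht.1 j, ht.2 j⟩, ?_⟩
    simp only [h t ht]
    rfl

end Regularization

end AnisotropicGaussian

theorem theorem5p1 {Ω Ω₀ : Type*} [MeasurableSpace Ω] [MeasurableSpace Ω₀]
    (P : Measure Ω) [IsProbabilityMeasure P] (P₀ : Measure Ω₀) [IsProbabilityMeasure P₀]
    (N p : ℕ) (hN : 1 ≤ N) (hp : 1 ≤ p)
    (H : Fin N → ℝ) (hH_pos : ∀ j, 0 < H j) (hH_mono : Monotone H) (hH_le : ∀ j, H j ≤ 1)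
    (X : EuclideanSpace ℝ (Fin N) → Ω₀ → ℝ)
    (hX : AnisotropicGaussian.IsCenteredGaussianField X P₀)
    (hD1 : AnisotropicGaussian.ConditionD1 X P₀ H)
    (Xs : Fin p → EuclideanSpace ℝ (Fin N) → Ω → ℝ)
    (hXs : AnisotropicGaussian.AreIndependentCopies Xs P X P₀)
    (hcont : ∀ᵐ ω ∂P, ContinuousOn (AnisotropicGaussian.sampleFunction Xs ω)
      (AnisotropicGaussian.unitCube N)) :
    (∀ᵐ ω ∂P,
      dimH (AnisotropicGaussian.sampleFunction Xs ω '' AnisotropicGaussian.unitCube N) =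
        ENNReal.ofReal (min (p : ℝ) (∑ j, 1 / H j))) ∧
    (∀ᵐ ω ∂P,
      dimH (AnisotropicGaussian.graphOver (AnisotropicGaussian.sampleFunction Xs ω)
          (AnisotropicGaussian.unitCube N)) =
        -- the index `k : Fin N` stands for the number `k + 1` of `{1, …, N}`
        ENNReal.ofReal (min
          (⨅ k : Fin N, (∑ j ∈ Finset.Iic k, H k / H j) + ((N : ℝ) - ((k : ℝ) + 1)) +
            (1 - H k) * (p : ℝ))
          (∑ j, 1 / H j))) := by

  obtain ⟨Y, hY, hYX⟩ := AnisotropicGaussian.exists_isRegularGaussianField hX hD1 hXs hcont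
  have hval : ∀ᵐ ω ∂P, ∀ t ∈ Set.Icc (0 : Fin N → ℝ) 1,
      AnisotropicGaussian.sampleFunction Xs ω (WithLp.toLp 2 t) = WithLp.toLp 2 (Y t ω) := by
    filter_upwards [hYX] with ω hω t ht
    exact congrArg (WithLp.toLp 2) (funext fun i => (hω t ht i).symm)
  constructor
  · filter_upwards [hval, hY.ae_dimH_image_eq hN hp hH_pos hH_mono hH_le] with ω h1 h2
    rw [AnisotropicGaussian.image_unitCube_eq h1, ContinuousLinearEquiv.dimH_image, h2]
  · filter_upwards [hval, hY.ae_dimH_graph_eq hN hp hH_pos hH_mono hH_le] with ω h1 h2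
    rw [AnisotropicGaussian.graphOver_unitCube_eq h1, ContinuousLinearEquiv.dimH_image, h2]
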